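/- Let $R$ be a commutative Noetherian local ring with maximal ideal $\mathfrak m$ and infinite residue field. For a finitely generated $R$-module $M$ put $\operatorname{grade} M=\inf\{i:\operatorname{Ext}^i_R(M,R)\neq 0\}$, and for an ideal $J\subseteq R$ put $\operatorname{grade} J=\operatorname{grade} R/J$ (so the unit ideal has grade $\infty$). An ideal $J$ of a Noetherian ring $S$ is called Gorenstein if, for some integer $c$, $\operatorname{grade} S/J=\operatorname{pd}_S S/J=c$ and $\operatorname{Ext}^c_S(S/J,S)\cong S/J$. An ideal $I\subseteq R$ is called generically Gorenstein if $I R_P$ is a Gorenstein ideal of $R_P$ for every associated prime $P$ of $R/I$. Let $p\ge 1$ and $q\ge 3$ be integers, let $I\subset R$ be an ideal of grade $3$, and let $$0\to A_3\xrightarrow{d_3}A_2\xrightarrow{d_2}A_1\xrightarrow{d_1}R,\qquad A_1=R^{p+2},\ A_2=R^{p+q},\ A_3=R^{q-1},$$ be a (not necessarily minimal) free resolution of $R/I$ (so $I$ is a perfect ideal of grade $3$). For a decomposition $A_3=C\oplus L$ with $C\cong R^{q-2}$ and $L\cong R$, let $J_C=I_{q-2}(d_3|_C)$ be the ideal generated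 by the $(q-2)\times(q-2)$ minors of $d_3|_C\colon C\to A_2$. 1. There is a choice of $C$ with $\operatorname{grade} J_C\ge 4$ if and only if $I$ is generically Gorenstein. 2. Suppose in addition that $I$ is not itself Gorenstein or that $\operatorname{depth} R=\operatorname{grade}\mathfrak m\ge 4$. Then there is a choice of $C$ with $\operatorname{grade} J_C=4$ if and only if $I$ is generically Gorenstein. -/

import Mathlib

universe u

open CategoryTheory

noncomputable section

/-- The grade of a module `M` over `R`: the least `i` with `Ext^i_R(M, R) ≠ 0`, and `⊤` if there is
no such `i`. -/
def moduleGrade (R : Type u) [CommRing R] (M : Type u) [AddCommGroup M] [Module R M] : ℕ∞ :=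
  ⨅ (i : ℕ) (_ : Nontrivial (Abelian.Ext (ModuleCat.of R M) (ModuleCat.of R R) i)), (i : ℕ∞)

/-- The grade of an ideal `I` is the grade of the module `R ⧸ I`; the unit ideal has grade `⊤`. -/
def idealGrade {R : Type u} [CommRing R] (I : Ideal R) : ℕ∞ :=
  moduleGrade R (R ⧸ I)

/-- `I` is a perfect ideal of grade `c`: the grade and the projective dimension of `R ⧸ I` are both
equal to the natural number `c` (so `I` is a proper ideal). -/
def IsPerfectOfGrade {R : Type u} [CommRing R] (I : Ideal R) (c : ℕ) : Prop :=
  idealGrade I = c ∧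
    projectiveDimension (ModuleCat.of R (R ⧸ I)) = ((c : ℕ∞) : WithBot ℕ∞)

/-- `I` is a Gorenstein ideal: it is perfect of some grade `c` and `Ext^c(R/I, R) ≅ R/I`. -/
def IsGorensteinIdeal {R : Type u} [CommRing R] (I : Ideal R) : Prop :=
  ∃ c : ℕ, IsPerfectOfGrade I c ∧
    Nonempty (Abelian.Ext (ModuleCat.of R (R ⧸ I)) (ModuleCat.of R R) c ≃ₗ[R] (R ⧸ I))

/-- `I` is generically Gorenstein: it becomes a Gorenstein ideal after localization at each
associated prime of `R ⧸ I`. (If `R` is Cohen–Macaulay and `I` is perfect, then `R ⧸ I` has no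
embedded primes and these are the minimal primes of `I`.) -/
def IsGenericallyGorenstein {R : Type u} [CommRing R] (I : Ideal R) : Prop :=
  ∀ (P : Ideal R) [P.IsPrime], P ∈ associatedPrimes R (R ⧸ I) →
    IsGorensteinIdeal (I.map (algebraMap R (Localization.AtPrime P)))

/-- The ideal `I_k(f)` of `k × k` minors of a linear map `f : M → N` of finite free modules, in
coordinate-free form: the image of the map `⋀^k M ⊗ ⋀^k N^* → R` induced by `f`. By
multilinearity it is generated by the `k × k` minors of the matrix of `f` in any pair of bases. -/
def minorIdeal {R : Type u} [CommRing R] {M N : Type u} [AddCommGroup M] [Module R M]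
    [AddCommGroup N] [Module R N] (k : ℕ) (f : M →ₗ[R] N) : Ideal R :=
  Ideal.span {r | ∃ (x : Fin k → M) (φ : Fin k → Module.Dual R N),
    r = (Matrix.of fun i j => φ i (f (x j))).det}

/-- `C` is the first summand of a decomposition `A = C ⊕ L` with `C ≅ R^k` and `L ≅ R`. -/
def IsCorankOneSummand {R : Type u} [CommRing R] {A : Type u} [AddCommGroup A] [Module R A]
    (k : ℕ) (C : Submodule R A) : Prop :=
  ∃ L : Submodule R A, IsCompl C L ∧ Nonempty (C ≃ₗ[R] (Fin k → R)) ∧ Nonempty (L ≃ₗ[R] R)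

/-- The complex `0 → A₃ → A₂ → A₁ → R` is a resolution of `R ⧸ I`. -/
structure IsResolutionOfQuotient {R : Type u} [CommRing R] {A₁ A₂ A₃ : Type u}
    [AddCommGroup A₁] [Module R A₁] [AddCommGroup A₂] [Module R A₂] [AddCommGroup A₃] [Module R A₃]
    (d₁ : A₁ →ₗ[R] R) (d₂ : A₂ →ₗ[R] A₁) (d₃ : A₃ →ₗ[R] A₂) (I : Ideal R) : Prop where
  range_d₁ : LinearMap.range d₁ = I
  exact_d₂_d₁ : Function.Exact d₂ d₁
  exact_d₃_d₂ : Function.Exact d₃ d₂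
  injective_d₃ : Function.Injective d₃

end

set_option linter.unusedSectionVars false

/-! Put ω = Ext³(R/I, R) = coker D₃ᵀ. Since grade I = 3, the dual of the resolution is again acyclic
and resolves ω, and contracting homotopies on the two complexes show that I is exactly the
annihilator of ω (`IsBiacyclic.mem_iff`). Hence I is Gorenstein iff ω is cyclic, and likewise after
localization at a prime containing I.

A summand C of corank one is the kernel of a unimodular x in the dual of A₃, and J_C is the zeroth
Fitting ideal of ω/Rx. Two consequences suffice: J_C kills ω/Rx by Cramer's rule, and J_C lies in a
prime P iff D₃ kills modulo P some vector of C that is nonzero modulo P.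

Grade at least 4 means that J_C lies in no associated prime of R/I. One direction is Hom(R/J_C, R/I)
= 0, by shifting along the resolution. Conversely, J_C ⊆ P forces I ⊆ P, so grade J_C ≥ 3, and
`IsAcyclic.subsingleton_ext_three` removes Ext³(R/J_C, R). At an associated prime P, J_C ⊄ P makes
ω_P cyclic; conversely, if ω_P is cyclic, it is enough that x be nonzero in the fiber of ω at P.
Over an infinite residue field a general x meets these finitely many conditions.

If grade J_C ≥ 5, then 1 ↦ x embeds R/I in ω with a cokernel whose Ext⁴ into R vanishes. So Ext³(ω,
R) ≅ R/I maps onto Ext³(R/I, R) = ω, and I is Gorenstein. When I is Gorenstein and depth R ≥ 4, x is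
taken to represent r times a generator of ω, with r in the maximal ideal and regular on R/I; grade
at least 5 would make r surjective on ω, against Nakayama. -/

/-- `Ext^i_R(M, N)` for modules `M`, `N` in the universe of `R`. -/
abbrev ModuleExt (R : Type u) [CommRing R] (M N : Type u) [AddCommGroup M] [Module R M]
    [AddCommGroup N] [Module R N] (i : ℕ) : Type u :=
  Abelian.Ext (ModuleCat.of R M) (ModuleCat.of R N) i

/-! ### Long exact sequences of Ext and dimension shifting -/

namespace ModuleExt

variable {R : Type u} [CommRing R] {A B C M N : Type u} [AddCommGroup A] [Module R A]
  [AddCommGroup B] [Module R B] [AddCommGroup C] [Module R C]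
  [AddCommGroup M] [Module R M] [AddCommGroup N] [Module R N]

/-- The short complex of modules attached to an exact pair of linear maps. -/
abbrev complexOfExact (f : B →ₗ[R] A) (g : A →ₗ[R] C) (hfg : Function.Exact f g) :
    ShortComplex (ModuleCat.{u} R) :=
  ModuleCat.shortComplexOfCompEqZero f g hfg.linearMap_comp_eq_zero

theorem shortExact_complexOfExact {f : B →ₗ[R] A} {g : A →ₗ[R] C}
    (hf : Function.Injective f) (hfg : Function.Exact f g) (hg : Function.Surjective g) :
    (complexOfExact f g hfg).ShortExact :=
  ModuleCat.shortComplex_shortExact _ hfg hf hg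

theorem nonempty_zero_equiv : Nonempty (ModuleExt R M N 0 ≃ₗ[R] (M →ₗ[R] N)) :=
  ⟨(Abelian.Ext.linearEquiv₀ (R := R)).trans ModuleCat.homLinearEquiv⟩

theorem subsingleton_zero_iff : Subsingleton (ModuleExt R M N 0) ↔ Subsingleton (M →ₗ[R] N) :=
  (nonempty_zero_equiv (R := R) (M := M) (N := N)).some.toEquiv.subsingleton_congr

theorem nonempty_shift_equiv [Module.Projective R A] {f : B →ₗ[R] A} {g : A →ₗ[R] C}
    (hf : Function.Injective f) (hfg : Function.Exact f g) (hg : Function.Surjective g) (i : ℕ) :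
    Nonempty (ModuleExt R B N (i + 1) ≃ₗ[R] ModuleExt R C N (i + 2)) := by
  have hS := shortExact_complexOfExact hf hfg hg
  have : Projective (complexOfExact f g hfg).X₂ :=
    ModuleCat.projective_of_categoryTheory_projective (ModuleCat.of R A)
  refine ⟨LinearEquiv.ofBijective
    (hS.extClass.precompOfLinear R (ModuleCat.of R N) (a := i + 1) (b := i + 2) (by omega))
    ⟨?_, ?_⟩⟩
  · rw [← LinearMap.ker_eq_bot, LinearMap.ker_eq_bot']
    intro x hx
    obtain ⟨y, rfl⟩ := Abelian.Ext.contravariant_sequence_exact₁ hS _ x (by omega) hx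
    rw [Abelian.Ext.eq_zero_of_projective y, Abelian.Ext.comp_zero]
  · intro x
    exact Abelian.Ext.contravariant_sequence_exact₃ hS _ x
      (Abelian.Ext.eq_zero_of_projective _) (by omega)

/-- The degree 0 to 1 part of the contravariant sequence, where Hom(A, N) does not vanish: Ext¹(C,
N) is Hom(B, N) modulo the maps that extend to A. -/
theorem exists_connecting_one [Module.Projective R A] {f : B →ₗ[R] A} {g : A →ₗ[R] C}
    (hf : Function.Injective f) (hfg : Function.Exact f g) (hg : Function.Surjective g) :
    ∃ δ : (B →ₗ[R] N) →ₗ[R] ModuleExt R C N 1, Function.Surjective δ ∧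
      ∀ φ, δ φ = 0 ↔ ∃ ψ : A →ₗ[R] N, ψ ∘ₗ f = φ := by
  have hS := shortExact_complexOfExact hf hfg hg
  have : Projective (complexOfExact f g hfg).X₂ :=
    ModuleCat.projective_of_categoryTheory_projective (ModuleCat.of R A)
  let e : (B →ₗ[R] N) ≃ₗ[R] ModuleExt R B N 0 :=
    ((Abelian.Ext.linearEquiv₀ (R := R)).trans ModuleCat.homLinearEquiv).symm
  have he (φ : B →ₗ[R] N) : e φ = Abelian.Ext.mk₀ (ModuleCat.ofHom φ) := rfl
  refine ⟨(hS.extClass.precompOfLinear R (ModuleCat.of R N) (a := 0) (b := 1) rfl) ∘ₗ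
    e.toLinearMap, ?_, fun φ ↦ ⟨fun h ↦ ?_, ?_⟩⟩
  · intro x
    obtain ⟨y, hy⟩ := Abelian.Ext.contravariant_sequence_exact₃ hS _ x
      (Abelian.Ext.eq_zero_of_projective _) (n₀ := 0) rfl
    exact ⟨e.symm y, by simpa using! hy⟩
  · obtain ⟨y, hy⟩ := Abelian.Ext.contravariant_sequence_exact₁ hS _ (e φ) (n₁ := 1) rfl h
    obtain ⟨ψ, rfl⟩ := (Abelian.Ext.mk₀_bijective _ _).2 y
    rw [he, Abelian.Ext.mk₀_comp_mk₀] at hy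
    refine ⟨ψ.hom, ?_⟩
    have := (Abelian.Ext.mk₀_bijective _ _).1 hy
    exact congrArg ModuleCat.Hom.hom this
  · rintro ⟨ψ, rfl⟩
    have : e (ψ ∘ₗ f) = (Abelian.Ext.mk₀ (complexOfExact f g hfg).f).comp
        (Abelian.Ext.mk₀ (ModuleCat.ofHom ψ)) (zero_add 0) := by
      rw [he, Abelian.Ext.mk₀_comp_mk₀]; rfl
    change hS.extClass.comp (e (ψ ∘ₗ f)) (rfl : 1 + 0 = 1) = 0
    rw [this, hS.extClass_comp_assoc]

theorem surjective_precomp {f : B →ₗ[R] A} {g : A →ₗ[R] C}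
    (hf : Function.Injective f) (hfg : Function.Exact f g) (hg : Function.Surjective g) {i : ℕ}
    (h : Subsingleton (ModuleExt R C N (i + 1))) :
    Function.Surjective ((Abelian.Ext.mk₀ (ModuleCat.ofHom f)).precompOfLinear R
      (ModuleCat.of R N) (a := i) (b := i) (zero_add i)) := by
  have hS := shortExact_complexOfExact hf hfg hg
  intro x
  exact Abelian.Ext.contravariant_sequence_exact₁ hS _ x (add_comm 1 i) (h.elim _ _)

theorem subsingleton_right {f : B →ₗ[R] A} {g : A →ₗ[R] C}
    (hf : Function.Injective f) (hfg : Function.Exact f g) (hg : Function.Surjective g) {i : ℕ}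
    (hA : Subsingleton (ModuleExt R M A i)) (hB : Subsingleton (ModuleExt R M B (i + 1))) :
    Subsingleton (ModuleExt R M C i) := by
  have hS := shortExact_complexOfExact hf hfg hg
  refine subsingleton_of_forall_eq 0 fun x ↦ ?_
  obtain ⟨y, rfl⟩ := Abelian.Ext.covariant_sequence_exact₃ _ hS x rfl (hB.elim _ _)
  rw [hA.elim y 0, Abelian.Ext.zero_comp]

theorem eq_zero_of_postcomp_eq_zero {f : B →ₗ[R] A} {g : A →ₗ[R] C}
    (hf : Function.Injective f) (hfg : Function.Exact f g) (hg : Function.Surjective g) {i : ℕ}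
    (hC : Subsingleton (ModuleExt R M C i)) (x : ModuleExt R M B (i + 1))
    (hx : x.comp (Abelian.Ext.mk₀ (ModuleCat.ofHom f)) (add_zero _) = 0) : x = 0 := by
  have hS := shortExact_complexOfExact hf hfg hg
  obtain ⟨y, rfl⟩ := Abelian.Ext.covariant_sequence_exact₁ _ hS x hx rfl
  rw [hC.elim y 0, Abelian.Ext.zero_comp]

theorem subsingleton_left {f : B →ₗ[R] A} {g : A →ₗ[R] C}
    (hf : Function.Injective f) (hfg : Function.Exact f g) (hg : Function.Surjective g) {i : ℕ}
    (hC : Subsingleton (ModuleExt R M C i)) (hA : Subsingleton (ModuleExt R M A (i + 1))) :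
    Subsingleton (ModuleExt R M B (i + 1)) :=
  subsingleton_of_forall_eq 0 fun x ↦
    eq_zero_of_postcomp_eq_zero hf hfg hg hC x (hA.elim _ _)

theorem postcomp_sum {ι : Type*} (s : Finset ι) (f : ι → (A →ₗ[R] B)) {i : ℕ}
    (x : ModuleExt R M A i) :
    x.comp (Abelian.Ext.mk₀ (ModuleCat.ofHom (∑ j ∈ s, f j))) (add_zero i) =
      ∑ j ∈ s, x.comp (Abelian.Ext.mk₀ (ModuleCat.ofHom (f j))) (add_zero i) := by
  let T : (A →ₗ[R] B) →+ ModuleExt R M B i :=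
    { toFun := fun φ ↦ x.comp (Abelian.Ext.mk₀ (ModuleCat.ofHom φ)) (add_zero i)
      map_zero' := by
        rw [show ModuleCat.ofHom (0 : A →ₗ[R] B) = 0 from rfl]; simp
      map_add' := fun a b ↦ by
        rw [show ModuleCat.ofHom (a + b) = ModuleCat.ofHom a + ModuleCat.ofHom b from rfl,
          Abelian.Ext.mk₀_add, Abelian.Ext.comp_add] }
  exact map_sum T f s

theorem postcomp_smul (r : R) (f : A →ₗ[R] B) {i : ℕ} (x : ModuleExt R M A i) :
    x.comp (Abelian.Ext.mk₀ (ModuleCat.ofHom (r • f))) (add_zero i) =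
      r • x.comp (Abelian.Ext.mk₀ (ModuleCat.ofHom f)) (add_zero i) := by
  rw [← Abelian.Ext.comp_smul, ← Abelian.Ext.mk₀_smul]; rfl

theorem postcomp_postcomp (f : A →ₗ[R] B) (g : B →ₗ[R] C) {i : ℕ} (x : ModuleExt R M A i) :
    (x.comp (Abelian.Ext.mk₀ (ModuleCat.ofHom f)) (add_zero i)).comp
      (Abelian.Ext.mk₀ (ModuleCat.ofHom g)) (add_zero i) =
      x.comp (Abelian.Ext.mk₀ (ModuleCat.ofHom (g ∘ₗ f))) (add_zero i) := by
  rw [Abelian.Ext.comp_assoc_of_third_deg_zero, Abelian.Ext.mk₀_comp_mk₀]; rfl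

theorem postcomp_id {i : ℕ} (x : ModuleExt R M A i) :
    x.comp (Abelian.Ext.mk₀ (ModuleCat.ofHom (LinearMap.id : A →ₗ[R] A))) (add_zero i) = x :=
  x.comp_mk₀_id

theorem subsingleton_pi {ι : Type} [Fintype ι] {i : ℕ} (h : Subsingleton (ModuleExt R M N i)) :
    Subsingleton (ModuleExt R M (ι → N) i) := by
  classical
  refine subsingleton_of_forall_eq 0 fun x ↦ ?_
  have hid : (LinearMap.id : (ι → N) →ₗ[R] (ι → N)) =
      ∑ j, LinearMap.single R (fun _ ↦ N) j ∘ₗ LinearMap.proj j := by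
    ext; simp
  rw [← postcomp_id x, hid, postcomp_sum]
  refine Finset.sum_eq_zero fun j _ ↦ ?_
  rw [← postcomp_postcomp, h.elim (x.comp _ _) 0, Abelian.Ext.zero_comp]

theorem smul_eq_zero_of_annihilates {r : R} (hr : ∀ m : M, r • m = 0) {i : ℕ}
    (x : ModuleExt R M N i) : r • x = 0 := by
  have h0 : r • 𝟙 (ModuleCat.of R M) = 0 := by
    ext m; exact hr m
  have : r • x = (Abelian.Ext.mk₀ (r • 𝟙 (ModuleCat.of R M))).comp x (zero_add i) := by
    simp [Abelian.Ext.mk₀_smul]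
  rw [this, h0, Abelian.Ext.mk₀_zero, Abelian.Ext.zero_comp]

theorem subsingleton_of_subsingleton (h : Subsingleton M) (i : ℕ) :
    Subsingleton (ModuleExt R M N i) := by
  refine subsingleton_of_forall_eq 0 fun x ↦ ?_
  rw [← one_smul R x]
  exact smul_eq_zero_of_annihilates (fun m ↦ h.elim _ _) x

/-! ### Ext computed from a resolution of length three -/

section Resolution

variable {A₀ A₁ A₂ A₃ : Type u} [AddCommGroup A₀] [Module R A₀] [AddCommGroup A₁] [Module R A₁]
  [AddCommGroup A₂] [Module R A₂] [AddCommGroup A₃] [Module R A₃]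
  {ε : A₀ →ₗ[R] M} {d₁ : A₁ →ₗ[R] A₀} {d₂ : A₂ →ₗ[R] A₁} {d₃ : A₃ →ₗ[R] A₂}

theorem exact_rangeRestrict {f : B →ₗ[R] A} {g : A →ₗ[R] C} (h : Function.Exact f g) :
    Function.Exact f g.rangeRestrict := by
  intro x
  rw [← h x, Subtype.ext_iff]; rfl

theorem exact_subtype_range {f : B →ₗ[R] A} {g : A →ₗ[R] C} (h : Function.Exact f g) :
    Function.Exact (LinearMap.range f).subtype g := by
  intro x
  rw [h x]; simp

theorem exists_factor {f : B →ₗ[R] A} {g : A →ₗ[R] C} (h : Function.Exact f g)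
    (hg : Function.Surjective g) (φ : A →ₗ[R] N) (hφ : φ ∘ₗ f = 0) :
    ∃ ψ : C →ₗ[R] N, ψ ∘ₗ g = φ := by
  have hker : LinearMap.ker g ≤ LinearMap.ker φ := by
    intro x hx
    obtain ⟨y, rfl⟩ := (h x).1 hx
    exact LinearMap.congr_fun hφ y
  refine ⟨((LinearMap.ker g).liftQ φ hker) ∘ₗ
    (g.quotKerEquivOfSurjective hg).symm.toLinearMap, ?_⟩
  ext x
  have : (g.quotKerEquivOfSurjective hg).symm (g x) = Submodule.Quotient.mk x := by
    rw [LinearEquiv.symm_apply_eq]; rfl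
  simp [this]

theorem subsingleton_zero_iff_of_exact (hε : Function.Surjective ε) (h₁ : Function.Exact d₁ ε) :
    Subsingleton (ModuleExt R M N 0) ↔ ∀ φ : A₀ →ₗ[R] N, φ ∘ₗ d₁ = 0 → φ = 0 := by
  rw [subsingleton_zero_iff]
  refine ⟨fun h φ hφ ↦ ?_, fun h ↦ subsingleton_of_forall_eq 0 fun φ ↦ ?_⟩
  · obtain ⟨ψ, rfl⟩ := exists_factor h₁ hε φ hφ
    rw [h.elim ψ 0, LinearMap.zero_comp]
  · have := h (φ ∘ₗ ε) (by
      rw [LinearMap.comp_assoc, h₁.linearMap_comp_eq_zero, LinearMap.comp_zero])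
    exact (LinearMap.cancel_right hε).1 (by simpa using this)

theorem subsingleton_one_iff_of_exact [Module.Projective R A₀] (hε : Function.Surjective ε)
    (h₁ : Function.Exact d₁ ε) (h₂ : Function.Exact d₂ d₁) :
    Subsingleton (ModuleExt R M N 1) ↔
      ∀ φ : A₁ →ₗ[R] N, φ ∘ₗ d₂ = 0 → ∃ ψ : A₀ →ₗ[R] N, ψ ∘ₗ d₁ = φ := by
  obtain ⟨δ, hδ, hker⟩ := exists_connecting_one (N := N) (Submodule.injective_subtype _)
    (exact_subtype_range h₁) hε
  have hd : (LinearMap.range d₁).subtype ∘ₗ d₁.rangeRestrict = d₁ := by ext; rfl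
  refine ⟨fun h φ hφ ↦ ?_, fun h ↦ subsingleton_of_forall_eq 0 fun x ↦ ?_⟩
  · obtain ⟨χ, rfl⟩ := exists_factor (exact_rangeRestrict h₂) d₁.surjective_rangeRestrict φ hφ
    obtain ⟨ψ, rfl⟩ := (hker χ).1 (h.elim _ _)
    exact ⟨ψ, by rw [LinearMap.comp_assoc, hd]⟩
  · obtain ⟨χ, rfl⟩ := hδ x
    rw [hker]
    obtain ⟨ψ, hψ⟩ := h (χ ∘ₗ d₁.rangeRestrict) (by
      rw [LinearMap.comp_assoc, (exact_rangeRestrict h₂).linearMap_comp_eq_zero,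
        LinearMap.comp_zero])
    refine ⟨ψ, (LinearMap.cancel_right d₁.surjective_rangeRestrict).1 ?_⟩
    rw [LinearMap.comp_assoc, hd, hψ]

theorem subsingleton_two_iff_of_exact [Module.Projective R A₀] [Module.Projective R A₁]
    (hε : Function.Surjective ε) (h₁ : Function.Exact d₁ ε) (h₂ : Function.Exact d₂ d₁)
    (h₃ : Function.Exact d₃ d₂) :
    Subsingleton (ModuleExt R M N 2) ↔
      ∀ φ : A₂ →ₗ[R] N, φ ∘ₗ d₃ = 0 → ∃ ψ : A₁ →ₗ[R] N, ψ ∘ₗ d₂ = φ := by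
  obtain ⟨e⟩ := nonempty_shift_equiv (N := N) (Submodule.injective_subtype _)
    (exact_subtype_range h₁) hε 0
  rw [← e.toEquiv.subsingleton_congr]
  exact subsingleton_one_iff_of_exact d₁.surjective_rangeRestrict (exact_rangeRestrict h₂) h₃

/-- Two dimension shifts through the syzygies reduce Ext³ to Ext¹ of the image of `d₂`, which `d₃`
presents. -/
theorem exists_three_presentation [Module.Projective R A₀] [Module.Projective R A₁]
    [Module.Projective R A₂] (hε : Function.Surjective ε) (h₁ : Function.Exact d₁ ε)
    (h₂ : Function.Exact d₂ d₁) (h₃ : Function.Exact d₃ d₂) (hd₃ : Function.Injective d₃) :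
    ∃ δ : (A₃ →ₗ[R] N) →ₗ[R] ModuleExt R M N 3, Function.Surjective δ ∧
      ∀ φ, δ φ = 0 ↔ ∃ ψ : A₂ →ₗ[R] N, ψ ∘ₗ d₃ = φ := by
  obtain ⟨e⟩ := nonempty_shift_equiv (N := N) (Submodule.injective_subtype _)
    (exact_subtype_range h₁) hε 1
  obtain ⟨e'⟩ := nonempty_shift_equiv (N := N) (Submodule.injective_subtype _)
    (exact_subtype_range (exact_rangeRestrict h₂)) d₁.surjective_rangeRestrict 0
  obtain ⟨δ, hδ, hker⟩ := exists_connecting_one (N := N) hd₃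
    (exact_rangeRestrict h₃) d₂.surjective_rangeRestrict
  refine ⟨(e'.trans e).toLinearMap ∘ₗ δ, (e'.trans e).surjective.comp hδ, fun φ ↦ ?_⟩
  rw [← hker]
  exact (e'.trans e).map_eq_zero_iff

theorem hasProjectiveDimensionLT_succ [Module.Projective R A] {f : B →ₗ[R] A} {g : A →ₗ[R] C}
    (hf : Function.Injective f) (hfg : Function.Exact f g) (hg : Function.Surjective g) (k : ℕ)
    (h : HasProjectiveDimensionLT (ModuleCat.of R B) (k + 1)) :
    HasProjectiveDimensionLT (ModuleCat.of R C) (k + 2) := by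
  have hS := shortExact_complexOfExact hf hfg hg
  have : Projective (complexOfExact f g hfg).X₂ :=
    ModuleCat.projective_of_categoryTheory_projective (ModuleCat.of R A)
  exact (hS.hasProjectiveDimensionLT_X₃_iff k this).2 h

theorem hasProjectiveDimensionLT_four [Module.Projective R A₀] [Module.Projective R A₁]
    [Module.Projective R A₂] [Module.Projective R A₃] (hε : Function.Surjective ε)
    (h₁ : Function.Exact d₁ ε) (h₂ : Function.Exact d₂ d₁) (h₃ : Function.Exact d₃ d₂)
    (hd₃ : Function.Injective d₃) : HasProjectiveDimensionLT (ModuleCat.of R M) 4 := by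
  have : Projective (ModuleCat.of R A₃) := ModuleCat.projective_of_categoryTheory_projective _
  refine hasProjectiveDimensionLT_succ (Submodule.injective_subtype _)
    (exact_subtype_range h₁) hε 2 <| hasProjectiveDimensionLT_succ (Submodule.injective_subtype _)
    (exact_subtype_range (exact_rangeRestrict h₂)) d₁.surjective_rangeRestrict 1 <|
    hasProjectiveDimensionLT_succ hd₃ (exact_rangeRestrict h₃) d₂.surjective_rangeRestrict 0
    inferInstance

end Resolution

end ModuleExt

/-! ### Grade as vanishing of Ext -/

section Grade

variable {R : Type u} [CommRing R]

theorem le_moduleGrade_iff {M : Type u} [AddCommGroup M] [Module R M] (n : ℕ) :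
    (n : ℕ∞) ≤ moduleGrade R M ↔ ∀ i < n, Subsingleton (ModuleExt R M R i) := by
  simp only [moduleGrade, le_iInf_iff, Nat.cast_le]
  refine forall_congr' fun i ↦ ?_
  rw [← not_nontrivial_iff_subsingleton]
  constructor
  · intro h hi hn
    exact absurd (h hn) (by omega)
  · intro h hn
    by_contra hi
    exact h (by omega) hn

theorem moduleGrade_eq_iff {M : Type u} [AddCommGroup M] [Module R M] (n : ℕ) :
    moduleGrade R M = n ↔
      (∀ i < n, Subsingleton (ModuleExt R M R i)) ∧ Nontrivial (ModuleExt R M R n) := by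
  rw [← le_moduleGrade_iff]
  constructor
  · intro h
    refine ⟨h.ge, ?_⟩
    rw [← not_subsingleton_iff_nontrivial]
    intro hs
    have : ((n + 1 : ℕ) : ℕ∞) ≤ moduleGrade R M := by
      rw [le_moduleGrade_iff]
      intro i hi
      rcases Nat.lt_succ_iff_lt_or_eq.1 hi with hi | rfl
      · exact (le_moduleGrade_iff n).1 h.ge i hi
      · exact hs
    rw [h, Nat.cast_le] at this
    omega
  · rintro ⟨h, hn⟩
    exact le_antisymm (iInf₂_le n hn) h

end Grade


/-! ### Complexes of length three and their duals -/

namespace Matrix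

variable {S : Type u} [CommRing S] {m₀ m₁ m₂ m₃ : Type} [Fintype m₀] [Fintype m₁] [Fintype m₂]
  [Fintype m₃] [DecidableEq m₀] [DecidableEq m₁] [DecidableEq m₂] [DecidableEq m₃]

/-- The complex `0 → S^{m₃} → S^{m₂} → S^{m₁} → S^{m₀}` is exact except possibly at `S^{m₀}`. -/
structure IsAcyclic (D₁ : Matrix m₀ m₁ S) (D₂ : Matrix m₁ m₂ S) (D₃ : Matrix m₂ m₃ S) : Prop where
  exact₁ : Function.Exact D₂.mulVecLin D₁.mulVecLin
  exact₂ : Function.Exact D₃.mulVecLin D₂.mulVecLin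
  injective : Function.Injective D₃.mulVecLin

/-- The complex `0 → S^{m₃} → S^{m₂} → S^{m₁} → S^{m₀}` and its dual are both resolutions. -/
structure IsBiacyclic (D₁ : Matrix m₀ m₁ S) (D₂ : Matrix m₁ m₂ S) (D₃ : Matrix m₂ m₃ S) :
    Prop where
  acyclic : IsAcyclic D₁ D₂ D₃
  dual : IsAcyclic D₃ᵀ D₂ᵀ D₁ᵀ

variable {D₁ : Matrix m₀ m₁ S} {D₂ : Matrix m₁ m₂ S} {D₃ : Matrix m₂ m₃ S}

theorem exists_mul_eq_of_mulVec (D : Matrix m₀ m₁ S) (X : Matrix m₀ m₂ S)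
    (h : ∀ j, ∃ w, D *ᵥ w = fun i ↦ X i j) : ∃ H : Matrix m₁ m₂ S, D * H = X := by
  choose w hw using h
  refine ⟨fun i j ↦ w j i, ?_⟩
  ext i j
  exact congrFun (hw j) i

theorem exists_mul_eq_of_exact {E : Matrix m₁ m₂ S} {D : Matrix m₀ m₁ S}
    (h : Function.Exact E.mulVecLin D.mulVecLin) (X : Matrix m₁ m₃ S) (hX : D * X = 0) :
    ∃ H : Matrix m₂ m₃ S, E * H = X := by
  refine exists_mul_eq_of_mulVec E X fun j ↦ ?_
  refine (h _).1 ?_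
  ext i
  exact congrFun (congrFun hX i) j

theorem mul_eq_zero_of_exact {E : Matrix m₁ m₂ S} {D : Matrix m₀ m₁ S}
    (h : Function.Exact E.mulVecLin D.mulVecLin) : D * E = 0 := by
  have := h.linearMap_comp_eq_zero
  rw [← mulVecLin_mul] at this
  exact Matrix.toLin'.injective (by simpa [Matrix.toLin'_apply'] using this)

/-- A scalar killing the cokernel of `D₁` is homotopic to zero on the whole resolution. -/
theorem IsAcyclic.exists_mul_eq_smul_one (h : IsAcyclic D₁ D₂ D₃) {s : S} {G : Matrix m₁ m₀ S}
    (hG : D₁ * G = s • 1) : ∃ H : Matrix m₃ m₂ S, H * D₃ = s • 1 := by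
  have h12 := mul_eq_zero_of_exact h.exact₁
  have h23 := mul_eq_zero_of_exact h.exact₂
  obtain ⟨H₁, hH₁⟩ := exists_mul_eq_of_exact h.exact₁ (s • 1 - G * D₁) (by
    rw [Matrix.mul_sub, ← Matrix.mul_assoc, hG]; simp)
  obtain ⟨H₂, hH₂⟩ := exists_mul_eq_of_exact h.exact₂ (s • 1 - H₁ * D₂) (by
    rw [Matrix.mul_sub, ← Matrix.mul_assoc, hH₁, Matrix.sub_mul, Matrix.mul_assoc, h12]; simp)
  refine ⟨H₂, ?_⟩
  -- The complex stops here, so injectivity of `D₃` turns the last homotopy identity into a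
  -- one-sided one.
  have h0 : D₃ * (s • 1 - H₂ * D₃) = 0 := by
    rw [Matrix.mul_sub, ← Matrix.mul_assoc, hH₂, Matrix.sub_mul, Matrix.mul_assoc, h23]; simp
  have : s • (1 : Matrix m₃ m₃ S) - H₂ * D₃ = 0 := by
    ext i j
    have := h.injective (a₁ := fun i ↦ (s • (1 : Matrix m₃ m₃ S) - H₂ * D₃) i j) (a₂ := 0) (by
      rw [map_zero]
      ext i
      exact congrFun (congrFun h0 i) j)
    exact congrFun this i
  exact (sub_eq_zero.1 this).symm

/-- The homotopy argument is applied to the complex and to its dual: `s` kills coker D₁ iff it kills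
coker D₃ᵀ. -/
theorem IsBiacyclic.exists_mul_eq_smul_one_iff (h : IsBiacyclic D₁ D₂ D₃) (s : S) :
    (∃ G : Matrix m₁ m₀ S, D₁ * G = s • 1) ↔ ∃ H : Matrix m₃ m₂ S, H * D₃ = s • 1 := by
  refine ⟨fun ⟨G, hG⟩ ↦ h.acyclic.exists_mul_eq_smul_one hG, fun ⟨H, hH⟩ ↦ ?_⟩
  obtain ⟨G, hG⟩ := h.dual.exists_mul_eq_smul_one (s := s) (G := Hᵀ) (by
    rw [← transpose_mul, hH]; simp)
  refine ⟨Gᵀ, ?_⟩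
  rw [← transpose_transpose D₁, ← transpose_mul, hG]; simp

theorem dotProductEquiv_comp_mulVecLin (D : Matrix m₀ m₁ S) (y : m₀ → S) :
    dotProductEquiv S m₀ y ∘ₗ D.mulVecLin = dotProductEquiv S m₁ (Dᵀ *ᵥ y) := by
  refine LinearMap.ext fun v ↦ ?_
  simp [dotProduct_mulVec, mulVec_transpose]

section Ext

variable {M : Type u} [AddCommGroup M] [Module S M] {ε : (m₀ → S) →ₗ[S] M}

theorem dual_injective_iff (D : Matrix m₀ m₁ S) :
    (∀ φ : (m₀ → S) →ₗ[S] S, φ ∘ₗ D.mulVecLin = 0 → φ = 0) ↔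
      Function.Injective Dᵀ.mulVecLin := by
  rw [← LinearMap.ker_eq_bot, LinearMap.ker_eq_bot', (dotProductEquiv S m₀).surjective.forall]
  refine forall_congr' fun y ↦ ?_
  rw [dotProductEquiv_comp_mulVecLin, LinearEquiv.map_eq_zero_iff, LinearEquiv.map_eq_zero_iff]
  rfl

theorem dual_exact_iff {D : Matrix m₀ m₁ S} {E : Matrix m₁ m₂ S} (hDE : D * E = 0) :
    (∀ φ : (m₁ → S) →ₗ[S] S, φ ∘ₗ E.mulVecLin = 0 →
      ∃ ψ : (m₀ → S) →ₗ[S] S, ψ ∘ₗ D.mulVecLin = φ) ↔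
      Function.Exact Dᵀ.mulVecLin Eᵀ.mulVecLin := by
  have key : (∀ φ : (m₁ → S) →ₗ[S] S, φ ∘ₗ E.mulVecLin = 0 →
      ∃ ψ : (m₀ → S) →ₗ[S] S, ψ ∘ₗ D.mulVecLin = φ) ↔
      ∀ y, Eᵀ *ᵥ y = 0 → ∃ z, Dᵀ *ᵥ z = y := by
    rw [(dotProductEquiv S m₁).surjective.forall]
    refine forall_congr' fun y ↦ ?_
    rw [dotProductEquiv_comp_mulVecLin, LinearEquiv.map_eq_zero_iff,
      (dotProductEquiv S m₀).surjective.exists]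
    simp only [dotProductEquiv_comp_mulVecLin, EmbeddingLike.apply_eq_iff_eq]
  rw [key]
  refine ⟨fun h y ↦ ⟨fun hy ↦ h y hy, ?_⟩, fun h y hy ↦ (h y).1 hy⟩
  rintro ⟨z, rfl⟩
  rw [mulVecLin_apply, mulVecLin_apply, mulVec_mulVec, ← transpose_mul, hDE]
  simp

/-- The first three Ext modules into `S` are the homology of the dual complex away from its last
cokernel. -/
theorem IsAcyclic.dual_iff_subsingleton_ext (h : IsAcyclic D₁ D₂ D₃)
    (hε : Function.Surjective ε) (h₁ : Function.Exact D₁.mulVecLin ε) :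
    IsAcyclic D₃ᵀ D₂ᵀ D₁ᵀ ↔ ∀ i < 3, Subsingleton (ModuleExt S M S i) := by
  have e0 := ModuleExt.subsingleton_zero_iff_of_exact (N := S) hε h₁
  have e1 := ModuleExt.subsingleton_one_iff_of_exact (N := S) hε h₁ h.exact₁
  have e2 := ModuleExt.subsingleton_two_iff_of_exact (N := S) hε h₁ h.exact₁ h.exact₂
  rw [dual_injective_iff] at e0
  rw [dual_exact_iff (mul_eq_zero_of_exact h.exact₁)] at e1
  rw [dual_exact_iff (mul_eq_zero_of_exact h.exact₂)] at e2
  constructor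
  · intro hd i hi
    interval_cases i
    · exact e0.2 hd.injective
    · exact e1.2 hd.exact₂
    · exact e2.2 hd.exact₁
  · intro hs
    exact ⟨e2.1 (hs 2 (by norm_num)), e1.1 (hs 1 (by norm_num)), e0.1 (hs 0 (by norm_num))⟩

/-- The third `Ext` of a module resolved by `D₁, D₂, D₃` is the cokernel of `D₃ᵀ`. -/
theorem IsAcyclic.nonempty_ext_three_equiv (h : IsAcyclic D₁ D₂ D₃)
    (hε : Function.Surjective ε) (h₁ : Function.Exact D₁.mulVecLin ε) :
    Nonempty (ModuleExt S M S 3 ≃ₗ[S] ((m₃ → S) ⧸ LinearMap.range D₃ᵀ.mulVecLin)) := by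
  obtain ⟨δ, hδ, hker⟩ := ModuleExt.exists_three_presentation (N := S) hε h₁ h.exact₁ h.exact₂
    h.injective
  let T : (m₃ → S) →ₗ[S] ModuleExt S M S 3 := δ ∘ₗ (dotProductEquiv S m₃).toLinearMap
  have hT : Function.Surjective T := hδ.comp (dotProductEquiv S m₃).surjective
  have hk : LinearMap.ker T = LinearMap.range D₃ᵀ.mulVecLin := by
    ext y
    change δ (dotProductEquiv S m₃ y) = 0 ↔ ∃ z, D₃ᵀ *ᵥ z = y
    rw [hker, (dotProductEquiv S m₂).surjective.exists]
    simp only [dotProductEquiv_comp_mulVecLin, EmbeddingLike.apply_eq_iff_eq]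
  exact ⟨((Submodule.quotEquivOfEq _ _ hk.symm).trans (T.quotKerEquivOfSurjective hT)).symm⟩

theorem IsAcyclic.hasProjectiveDimensionLT (h : IsAcyclic D₁ D₂ D₃)
    (hε : Function.Surjective ε) (h₁ : Function.Exact D₁.mulVecLin ε) :
    HasProjectiveDimensionLT (ModuleCat.of S M) 4 :=
  ModuleExt.hasProjectiveDimensionLT_four hε h₁ h.exact₁ h.exact₂ h.injective

end Ext

/-! ### Localization of the complexes -/

section Localization

variable {R : Type u} [CommRing R] [Algebra R S]

/-- The coordinatewise localization map on vectors. -/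
abbrev vecLocalization (R S : Type u) [CommRing R] [CommRing S] [Algebra R S] (m : Type) :
    (m → R) →ₗ[R] (m → S) :=
  LinearMap.pi fun i ↦ Algebra.linearMap R S ∘ₗ LinearMap.proj i

theorem map_mulVecLin_eq (W : Submonoid R) [IsLocalization W S] (D : Matrix m₀ m₁ R) :
    IsLocalizedModule.map W (vecLocalization R S m₁) (vecLocalization R S m₀) D.mulVecLin =
      (D.map (algebraMap R S)).mulVecLin.restrictScalars R := by
  refine IsLocalizedModule.ext W (vecLocalization R S m₁)
    (IsLocalizedModule.map_units (vecLocalization R S m₀)) ?_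
  refine LinearMap.ext fun v ↦ ?_
  rw [LinearMap.comp_apply, IsLocalizedModule.map_apply]
  ext i
  simp [mulVec, dotProduct]

theorem exact_map (W : Submonoid R) [IsLocalization W S] {D : Matrix m₀ m₁ R} {E : Matrix m₁ m₂ R}
    (h : Function.Exact E.mulVecLin D.mulVecLin) :
    Function.Exact (E.map (algebraMap R S)).mulVecLin (D.map (algebraMap R S)).mulVecLin := by
  have := IsLocalizedModule.map_exact W (vecLocalization R S m₂) (vecLocalization R S m₁)
    (vecLocalization R S m₀) _ _ h
  rwa [map_mulVecLin_eq, map_mulVecLin_eq] at this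

theorem injective_map (W : Submonoid R) [IsLocalization W S] {D : Matrix m₀ m₁ R}
    (h : Function.Injective D.mulVecLin) :
    Function.Injective (D.map (algebraMap R S)).mulVecLin := by
  have := IsLocalizedModule.map_injective W (vecLocalization R S m₁) (vecLocalization R S m₀) _ h
  rwa [map_mulVecLin_eq] at this

theorem IsAcyclic.map (W : Submonoid R) [IsLocalization W S]
    {D₁ : Matrix m₀ m₁ R} {D₂ : Matrix m₁ m₂ R} {D₃ : Matrix m₂ m₃ R}
    (h : IsAcyclic D₁ D₂ D₃) : IsAcyclic (D₁.map (algebraMap R S)) (D₂.map (algebraMap R S))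
      (D₃.map (algebraMap R S)) :=
  ⟨exact_map W h.exact₁, exact_map W h.exact₂, injective_map W h.injective⟩

theorem IsBiacyclic.map (W : Submonoid R) [IsLocalization W S]
    {D₁ : Matrix m₀ m₁ R} {D₂ : Matrix m₁ m₂ R} {D₃ : Matrix m₂ m₃ R}
    (h : IsBiacyclic D₁ D₂ D₃) : IsBiacyclic (D₁.map (algebraMap R S)) (D₂.map (algebraMap R S))
      (D₃.map (algebraMap R S)) :=
  ⟨h.acyclic.map W, h.dual.map W⟩

end Localization

/-! ### The module ω = coker D₃ᵀ and Gorenstein ideals -/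

section Ideal

variable {I : Ideal S} {D : Matrix Unit m₁ S}

/-- The augmentation `S^1 → S ⧸ I`. -/
def augmentation (I : Ideal S) : (Unit → S) →ₗ[S] S ⧸ I :=
  I.mkQ ∘ₗ LinearMap.proj ()

theorem augmentation_surjective (I : Ideal S) : Function.Surjective (augmentation I) := by
  intro x
  obtain ⟨r, rfl⟩ := I.mkQ_surjective x
  exact ⟨fun _ ↦ r, rfl⟩

theorem mem_iff_exists_mulVec (hI : I = Ideal.span (Set.range (D ()))) (s : S) :
    s ∈ I ↔ ∃ w, D *ᵥ w = fun _ ↦ s := by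
  rw [hI, Ideal.mem_span_range_iff_exists_fun]
  refine exists_congr fun w ↦ ?_
  rw [funext_iff, Unique.forall_iff]
  simp [mulVec, dotProduct, mul_comm]

theorem exact_augmentation (hI : I = Ideal.span (Set.range (D ()))) :
    Function.Exact D.mulVecLin (augmentation I) := by
  intro v
  have : augmentation I v = 0 ↔ v () ∈ I := Submodule.Quotient.mk_eq_zero I
  rw [this, mem_iff_exists_mulVec hI]
  rfl

theorem mem_iff_exists_mul (hI : I = Ideal.span (Set.range (D ()))) (s : S) :
    s ∈ I ↔ ∃ G : Matrix m₁ Unit S, D * G = s • 1 := by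
  rw [mem_iff_exists_mulVec hI]
  constructor
  · rintro ⟨w, hw⟩
    refine exists_mul_eq_of_mulVec D _ fun j ↦ ⟨w, ?_⟩
    rw [hw]; ext; simp
  · rintro ⟨G, hG⟩
    refine ⟨fun i ↦ G i (), ?_⟩
    ext x
    have := congrFun (congrFun hG ()) ()
    simp only [smul_apply, one_apply_eq, smul_eq_mul, mul_one] at this
    exact this

variable {D₁ : Matrix Unit m₁ S}

/-- `I` is the annihilator of the cokernel of `D₃ᵀ`. -/
theorem IsBiacyclic.mem_iff (h : IsBiacyclic D₁ D₂ D₃)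
    (hI : I = Ideal.span (Set.range (D₁ ()))) (s : S) :
    s ∈ I ↔ ∀ y, ∃ z, D₃ᵀ *ᵥ z = s • y := by
  rw [mem_iff_exists_mul hI, h.exists_mul_eq_smul_one_iff]
  constructor
  · rintro ⟨H, hH⟩ y
    refine ⟨Hᵀ *ᵥ y, ?_⟩
    rw [mulVec_mulVec, ← transpose_mul, hH]
    simp [smul_mulVec]
  · intro hy
    obtain ⟨H, hH⟩ := exists_mul_eq_of_mulVec D₃ᵀ (s • (1 : Matrix m₃ m₃ S)) fun j ↦ by
      obtain ⟨z, hz⟩ := hy (fun i ↦ (1 : Matrix m₃ m₃ S) i j)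
      exact ⟨z, hz⟩
    refine ⟨Hᵀ, ?_⟩
    rw [← transpose_transpose D₃, ← transpose_mul, hH]; simp

theorem IsBiacyclic.moduleGrade_eq (h : IsBiacyclic D₁ D₂ D₃)
    (hI : I = Ideal.span (Set.range (D₁ ()))) (hne : I ≠ ⊤) : idealGrade I = (3 : ℕ) := by
  rw [idealGrade, moduleGrade_eq_iff]
  refine ⟨(h.acyclic.dual_iff_subsingleton_ext (augmentation_surjective I)
    (exact_augmentation hI)).1 h.dual, ?_⟩
  obtain ⟨e⟩ := h.acyclic.nonempty_ext_three_equiv (augmentation_surjective I)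
    (exact_augmentation hI)
  rw [e.toEquiv.nontrivial_congr, Submodule.Quotient.nontrivial_iff]
  intro htop
  refine hne ((Ideal.eq_top_iff_one I).2 ((h.mem_iff hI 1).2 fun y ↦ ?_))
  rw [one_smul]
  exact LinearMap.range_eq_top.1 htop y

/-- Ext³(S/I, S) is ω, whose annihilator is `I`; hence ω ≅ S/I as soon as a single `g` generates it.
-/
theorem IsBiacyclic.isGorensteinIdeal_iff (h : IsBiacyclic D₁ D₂ D₃)
    (hI : I = Ideal.span (Set.range (D₁ ()))) (hne : I ≠ ⊤) :
    IsGorensteinIdeal I ↔ ∃ g : m₃ → S, ∀ y, ∃ (t : S) (z : m₂ → S), y = t • g + D₃ᵀ *ᵥ z := by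
  have hgr := h.moduleGrade_eq hI hne
  obtain ⟨e⟩ := h.acyclic.nonempty_ext_three_equiv (augmentation_surjective I)
    (exact_augmentation hI)
  constructor
  · rintro ⟨c, ⟨hc, -⟩, ⟨e'⟩⟩
    rw [hgr, Nat.cast_inj] at hc
    subst hc
    let E := e'.symm.trans e
    obtain ⟨g, hg⟩ := (LinearMap.range D₃ᵀ.mulVecLin).mkQ_surjective (E (Ideal.Quotient.mk I 1))
    refine ⟨g, fun y ↦ ?_⟩
    obtain ⟨t, ht⟩ := Ideal.Quotient.mk_surjective (E.symm ((LinearMap.range D₃ᵀ.mulVecLin).mkQ y))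
    have : (LinearMap.range D₃ᵀ.mulVecLin).mkQ (t • g) = (LinearMap.range D₃ᵀ.mulVecLin).mkQ y := by
      rw [map_smul, hg, ← map_smul]
      rw [LinearEquiv.eq_symm_apply] at ht
      rw [← ht]
      congr 1
      rw [Algebra.smul_def, map_one, mul_one]
      rfl
    obtain ⟨z, hz⟩ := (Submodule.Quotient.eq _).1 this.symm
    exact ⟨t, z, by rw [← Matrix.mulVecLin_apply, hz]; abel⟩
  · rintro ⟨g, hg⟩
    refine ⟨3, ⟨hgr, le_antisymm ?_ ?_⟩, ?_⟩
    · exact (projectiveDimension_le_iff _ 3).2 (h.acyclic.hasProjectiveDimensionLT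
        (augmentation_surjective I) (exact_augmentation hI))
    · refine (projectiveDimension_ge_iff _ 3).2 fun hpd ↦ ?_
      have h3 := ((moduleGrade_eq_iff 3).1 hgr).2
      rw [← not_subsingleton_iff_nontrivial] at h3
      exact h3 (HasProjectiveDimensionLT.subsingleton _ 3 3 le_rfl _)
    · let T : S →ₗ[S] (m₃ → S) ⧸ LinearMap.range D₃ᵀ.mulVecLin :=
        LinearMap.toSpanSingleton S _ (Submodule.Quotient.mk g)
      have hT : Function.Surjective T := by
        intro x
        obtain ⟨y, rfl⟩ := (LinearMap.range D₃ᵀ.mulVecLin).mkQ_surjective x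
        obtain ⟨t, z, rfl⟩ := hg y
        refine ⟨t, ?_⟩
        have hz : (LinearMap.range D₃ᵀ.mulVecLin).mkQ (D₃ᵀ *ᵥ z) = 0 :=
          (Submodule.Quotient.mk_eq_zero _).2 ⟨z, rfl⟩
        rw [map_add, hz, add_zero]
        rfl
      -- A scalar killing the generator kills all of ω.
      have hk : LinearMap.ker T = I := by
        ext s
        rw [h.mem_iff hI]
        have : s ∈ LinearMap.ker T ↔ ∃ z, D₃ᵀ *ᵥ z = s • g :=
          Submodule.Quotient.mk_eq_zero (LinearMap.range D₃ᵀ.mulVecLin)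
        rw [this]
        refine ⟨fun ⟨w, hw⟩ y ↦ ?_, fun hs ↦ hs g⟩
        obtain ⟨t, z, rfl⟩ := hg y
        refine ⟨t • w + s • z, ?_⟩
        rw [mulVec_add, mulVec_smul, mulVec_smul, hw, smul_add, smul_comm]
      exact ⟨e.trans ((T.quotKerEquivOfSurjective hT).symm.trans
        (Submodule.quotEquivOfEq _ _ hk))⟩

end Ideal

end Matrix

/-- Vanishing of `Ext^i(R ⧸ J, R)` for `i < n` passes to all finite modules supported on `V(J)`. -/
theorem ModuleExt.subsingleton_of_le_radical_annihilator {R : Type u} [CommRing R]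
    [IsNoetherianRing R] {J : Ideal R} {n : ℕ} (hJ : (n : ℕ∞) ≤ idealGrade J)
    {N : Type u} [AddCommGroup N] [Module R N] [Module.Finite R N]
    (hN : J ≤ (Module.annihilator R N).radical) :
    ∀ i < n, Subsingleton (ModuleExt R N R i) := by
  -- Rees' theorem, used in both directions through a regular sequence of length n in J, needs J
  -- proper.
  by_cases htop : J = ⊤
  · rw [htop, top_le_iff, Ideal.radical_eq_top] at hN
    have : Subsingleton N := Module.annihilator_eq_top_iff.1 hN
    exact fun i _ ↦ ModuleExt.subsingleton_of_subsingleton this i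
  · have hlt : J • (⊤ : Submodule R R) < ⊤ := by simpa [lt_top_iff_ne_top] using htop
    have hsupp : Module.support R (R ⧸ J) = PrimeSpectrum.zeroLocus J := by
      rw [Module.support_eq_zeroLocus, Ideal.annihilator_quotient]
    obtain ⟨rs, hlen, hmem, hreg⟩ := ModuleCat.exists_isRegular_of_exists_subsingleton_ext J n
      (ModuleCat.of R R) hlt (ModuleCat.of R (R ⧸ J)) hsupp ((le_moduleGrade_iff n).1 hJ)
    have hN' : Module.support R N ⊆ PrimeSpectrum.zeroLocus J := by
      rw [Module.support_eq_zeroLocus, PrimeSpectrum.zeroLocus_subset_zeroLocus_iff]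
      exact hN
    subst hlen
    exact ModuleCat.subsingleton_ext_of_exists_isRegular J (ModuleCat.of R N) hN'
      (ModuleCat.of R R) hlt rs hmem hreg

namespace Matrix

/-! ### Shifting along the resolution into the module that it resolves -/

section Shift

variable {S : Type u} [CommRing S] {m₀ m₁ m₂ m₃ : Type} [Fintype m₀] [Fintype m₁] [Fintype m₂]
  [Fintype m₃] [DecidableEq m₀] [DecidableEq m₁] [DecidableEq m₂] [DecidableEq m₃]
  {D₁ : Matrix m₀ m₁ S} {D₂ : Matrix m₁ m₂ S} {D₃ : Matrix m₂ m₃ S}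
  {M N : Type u} [AddCommGroup M] [Module S M] [AddCommGroup N] [Module S N]
  {ε : (m₀ → S) →ₗ[S] M}

/-- Each syzygy sequence trades one degree of Ext for one step of the resolution, so Hom(N, M) is
controlled by Ext⁰, …, Ext³ of N into S. -/
theorem IsAcyclic.subsingleton_hom (h : IsAcyclic D₁ D₂ D₃) (hε : Function.Surjective ε)
    (h₁ : Function.Exact D₁.mulVecLin ε) (hN : ∀ i < 4, Subsingleton (ModuleExt S N S i)) :
    Subsingleton (N →ₗ[S] M) := by
  rw [← ModuleExt.subsingleton_zero_iff]
  refine ModuleExt.subsingleton_right (Submodule.injective_subtype _)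
    (ModuleExt.exact_subtype_range h₁) hε (ModuleExt.subsingleton_pi (hN 0 (by norm_num))) ?_
  refine ModuleExt.subsingleton_right (Submodule.injective_subtype _)
    (ModuleExt.exact_subtype_range (ModuleExt.exact_rangeRestrict h.exact₁))
    D₁.mulVecLin.surjective_rangeRestrict (ModuleExt.subsingleton_pi (hN 1 (by norm_num))) ?_
  exact ModuleExt.subsingleton_right h.injective (ModuleExt.exact_rangeRestrict h.exact₂)
    D₂.mulVecLin.surjective_rangeRestrict (ModuleExt.subsingleton_pi (hN 2 (by norm_num)))
    (ModuleExt.subsingleton_pi (hN 3 (by norm_num)))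

/-- The kernel of Ext³(N, D₃) comes from Ext² of N into the image of `D₂`, which shifts down to
Hom(N, M) = 0. -/
theorem IsAcyclic.eq_zero_of_postcomp (h : IsAcyclic D₁ D₂ D₃) (hε : Function.Surjective ε)
    (h₁ : Function.Exact D₁.mulVecLin ε) (hN : ∀ i < 3, Subsingleton (ModuleExt S N S i))
    (hM : Subsingleton (N →ₗ[S] M)) (x : ModuleExt S N (m₃ → S) 3)
    (hx : x.comp (Abelian.Ext.mk₀ (ModuleCat.ofHom D₃.mulVecLin)) (add_zero _) = 0) : x = 0 := by
  rw [← ModuleExt.subsingleton_zero_iff] at hM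
  refine ModuleExt.eq_zero_of_postcomp_eq_zero h.injective
    (ModuleExt.exact_rangeRestrict h.exact₂) D₂.mulVecLin.surjective_rangeRestrict ?_ x hx
  refine ModuleExt.subsingleton_left (Submodule.injective_subtype _)
    (ModuleExt.exact_subtype_range (ModuleExt.exact_rangeRestrict h.exact₁))
    D₁.mulVecLin.surjective_rangeRestrict ?_ (ModuleExt.subsingleton_pi (hN 2 (by norm_num)))
  exact ModuleExt.subsingleton_left (Submodule.injective_subtype _)
    (ModuleExt.exact_subtype_range h₁) hε hM (ModuleExt.subsingleton_pi (hN 1 (by norm_num)))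

/-- If `D₃` degenerates modulo every associated prime of `Ext^3(N, S)` and `Hom(N, M) = 0`, then
`Ext^3(N, S) = 0`. -/
theorem IsAcyclic.subsingleton_ext_three [IsNoetherianRing S] (h : IsAcyclic D₁ D₂ D₃)
    (hε : Function.Surjective ε) (h₁ : Function.Exact D₁.mulVecLin ε)
    (hN : ∀ i < 3, Subsingleton (ModuleExt S N S i)) (hM : Subsingleton (N →ₗ[S] M))
    (hP : ∀ P ∈ associatedPrimes S (ModuleExt S N S 3),
      ∃ a : m₃ → S, (∃ j, a j ∉ P) ∧ ∀ i, (D₃ *ᵥ a) i ∈ P) :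
    Subsingleton (ModuleExt S N S 3) := by
  by_contra hne
  rw [not_subsingleton_iff_nontrivial] at hne
  obtain ⟨P, hass⟩ := associatedPrimes.nonempty S (ModuleExt S N S 3)
  obtain ⟨a, ⟨j, hj⟩, ha⟩ := hP P hass
  obtain ⟨hprime, e, he⟩ := (isAssociatedPrime_iff).1 hass
  have hmem (r : S) : r ∈ P ↔ r • e = 0 := by
    rw [he, Submodule.mem_colon_singleton, Submodule.mem_bot]
  -- Here P is the annihilator of `e`. The image of `e` along `a` dies under `D₃`, whose value at
  -- `a` has entries in P; injectivity of `D₃` on Ext³ kills that image, and its j-th coordinate is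
  -- `a j • e`.
  have hz : e.comp (Abelian.Ext.mk₀ (ModuleCat.ofHom (LinearMap.toSpanSingleton S _ a)))
      (add_zero _) = 0 := by
    refine h.eq_zero_of_postcomp hε h₁ hN hM _ ?_
    rw [ModuleExt.postcomp_postcomp]
    have hsum : D₃.mulVecLin ∘ₗ LinearMap.toSpanSingleton S _ a =
        ∑ i, (D₃ *ᵥ a) i • LinearMap.single S (fun _ ↦ S) i := by
      ext i
      simp [LinearMap.sum_apply, Pi.single_apply]
    rw [hsum, ModuleExt.postcomp_sum]
    refine Finset.sum_eq_zero fun i _ ↦ ?_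
    rw [ModuleExt.postcomp_smul, ← Abelian.Ext.smul_comp, (hmem _).1 (ha i),
      Abelian.Ext.zero_comp]
  refine hj ((hmem _).2 ?_)
  have hproj : a j • (LinearMap.id : S →ₗ[S] S) =
      LinearMap.proj j ∘ₗ LinearMap.toSpanSingleton S _ a := by
    ext; simp
  rw [← ModuleExt.postcomp_id e, ← ModuleExt.postcomp_smul, hproj,
    ← ModuleExt.postcomp_postcomp, hz, Abelian.Ext.zero_comp]

end Shift

/-! ### Maximal minors and rank modulo a prime -/

section Minors

variable {R : Type u} [CommRing R] {m n : Type} [Fintype m] [Fintype n] [DecidableEq m]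
  [DecidableEq n] (P : Ideal R) [P.IsPrime]

theorem exists_common_denominator {T : Type} [Finite T] (w : T → FractionRing (R ⧸ P)) :
    ∃ s ∉ P, ∃ a : T → R, ∀ t,
      algebraMap (R ⧸ P) (FractionRing (R ⧸ P)) (Ideal.Quotient.mk P s) * w t =
        algebraMap (R ⧸ P) (FractionRing (R ⧸ P)) (Ideal.Quotient.mk P (a t)) := by
  obtain ⟨b, hb⟩ := IsLocalization.exist_integer_multiples_of_finite (nonZeroDivisors (R ⧸ P)) w
  obtain ⟨s, hs⟩ := Ideal.Quotient.mk_surjective (b : R ⧸ P)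
  choose c hc using hb
  choose a ha using fun t ↦ Ideal.Quotient.mk_surjective (c t)
  refine ⟨s, ?_, a, fun t ↦ ?_⟩
  · rw [← Ideal.Quotient.eq_zero_iff_mem, hs]
    exact nonZeroDivisors.coe_ne_zero b
  · rw [ha, hc, hs, Algebra.smul_def]

/-- A matrix which stays injective modulo the prime `P` has a maximal minor outside `P`, up to
row combinations. -/
theorem exists_det_notMem (F : Matrix m n R)
    (hF : ∀ a : n → R, (∀ i, (F *ᵥ a) i ∈ P) → ∀ j, a j ∈ P) :
    ∃ Φ : Matrix n m R, (Φ * F).det ∉ P := by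
  let κ := FractionRing (R ⧸ P)
  let ι : R →+* κ := (algebraMap (R ⧸ P) κ).comp (Ideal.Quotient.mk P)
  have hι (r : R) : ι r = 0 ↔ r ∈ P := by
    rw [← Ideal.Quotient.eq_zero_iff_mem]
    exact map_eq_zero_iff _ (IsFractionRing.injective (R ⧸ P) κ)
  have hinj : Function.Injective (F.map ι).mulVecLin := by
    rw [← LinearMap.ker_eq_bot, LinearMap.ker_eq_bot']
    intro w hw
    obtain ⟨s, hs, a, ha⟩ := exists_common_denominator P w
    have ha' (j : n) : ι s * w j = ι (a j) := ha j
    have hFa : ∀ i, (F *ᵥ a) i ∈ P := by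
      intro i
      rw [← hι]
      have := congrFun hw i
      simp only [mulVecLin_apply, mulVec, dotProduct, map_apply, Pi.zero_apply] at this
      calc ι ((F *ᵥ a) i) = ι s * ∑ j, ι (F i j) * w j := by
            simp only [mulVec, dotProduct, map_sum, map_mul, Finset.mul_sum, ← ha']
            exact Finset.sum_congr rfl fun j _ ↦ by ring
        _ = 0 := by rw [this, mul_zero]
    ext j
    have := (hι _).2 (hF a hFa j)
    rw [← ha', mul_eq_zero, hι] at this
    exact this.resolve_left hs
  obtain ⟨g, hg⟩ := LinearMap.exists_leftInverse_of_injective _ (LinearMap.ker_eq_bot.2 hinj)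
  have hG : LinearMap.toMatrix' g * F.map ι = 1 := by
    have := congrArg LinearMap.toMatrix' hg
    rwa [LinearMap.toMatrix'_comp, LinearMap.toMatrix'_id, ← toLin'_apply',
      LinearMap.toMatrix'_toLin'] at this
  obtain ⟨s, hs, a, ha⟩ := exists_common_denominator P
    (fun t : n × m ↦ LinearMap.toMatrix' g t.1 t.2)
  let Φ : Matrix n m R := of fun i j ↦ a (i, j)
  have hΦ : Φ.map ι = ι s • LinearMap.toMatrix' g := by
    ext i j
    exact (ha (i, j)).symm
  -- Φ is a left inverse over the residue field of P with denominators cleared by `s`, so the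
  -- determinant is a power of `s` modulo P.
  refine ⟨Φ, ?_⟩
  rw [← hι, RingHom.map_det, RingHom.mapMatrix_apply, Matrix.map_mul, hΦ, smul_mul, hG, det_smul,
    det_one, mul_one]
  exact pow_ne_zero _ (by rwa [Ne, hι])

end Minors

end Matrix

/-! ### Hyperplanes and the minors of a restriction -/

namespace Matrix

/-- `C` is the kernel of the functional `x`, which takes the value `1` at `u`, and `b` is a basis
of `C`. -/
structure HyperplaneData {R : Type u} [CommRing R] {n : Type} [Fintype n] (k : ℕ)
    (C : Submodule R (n → R)) (x : n → R) where
  u : n → R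
  dot_u : x ⬝ᵥ u = 1
  mem_iff : ∀ v, v ∈ C ↔ x ⬝ᵥ v = 0
  b : Module.Basis (Fin k) R C

namespace HyperplaneData

variable {R : Type u} [CommRing R] {m n : Type} [Fintype m] [Fintype n] [DecidableEq m]
  [DecidableEq n] {k : ℕ} {C : Submodule R (n → R)} {x : n → R}

/-- The projection onto the hyperplane along `u`. -/
def proj (h : HyperplaneData k C x) : (n → R) →ₗ[R] C where
  toFun v := ⟨v - (x ⬝ᵥ v) • h.u, by
    rw [h.mem_iff, dotProduct_sub, dotProduct_smul, h.dot_u]; simp⟩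
  map_add' v w := by
    ext1; simp only [dotProduct_add, Submodule.coe_add]; module
  map_smul' r v := by
    ext1; simp only [dotProduct_smul, Submodule.coe_smul, RingHom.id_apply]; module

theorem proj_coe (h : HyperplaneData k C x) (c : C) : h.proj c = c := by
  ext1
  change (c : n → R) - (x ⬝ᵥ (c : n → R)) • h.u = c
  rw [(h.mem_iff c).1 c.2]; simp

theorem repr_mem (h : HyperplaneData k C x) (P : Ideal R) (c : C) (hc : ∀ j, (c : n → R) j ∈ P)
    (l : Fin k) : h.b.repr c l ∈ P := by
  have hc' : h.b.repr c l = (h.b.coord l ∘ₗ h.proj) (c : n → R) := by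
    simp [proj_coe]
  rw [hc', LinearMap.pi_apply_eq_sum_univ]
  exact Ideal.sum_mem _ fun j _ ↦ Ideal.mul_mem_right _ _ (hc j)

/-- The vectors of `C` together with `u` span, so a functional vanishing on `C` is determined by its
value at `u`. -/
theorem exists_eq_smul_of_forall_mem (h : HyperplaneData k C x) (y : n → R)
    (hy : ∀ c ∈ C, y ⬝ᵥ c = 0) : y = (y ⬝ᵥ h.u) • x := by
  have key (v : n → R) : y ⬝ᵥ v = ((y ⬝ᵥ h.u) • x) ⬝ᵥ v := by
    have := hy _ (h.proj v).2
    change y ⬝ᵥ (v - (x ⬝ᵥ v) • h.u) = 0 at this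
    rw [dotProduct_sub, sub_eq_zero] at this
    rw [this, dotProduct_smul, smul_dotProduct, smul_eq_mul, smul_eq_mul, mul_comm]
  ext j
  simpa using key (Pi.single j 1)

theorem minor_eq (h : HyperplaneData k C x) (f : C →ₗ[R] (m → R)) (v : Fin k → C)
    (φ : Fin k → Module.Dual R (m → R)) :
    (of fun i j ↦ φ i (f (v j))) =
      (of fun i l ↦ φ i (f (h.b l))) * of fun l j ↦ h.b.repr (v j) l := by
  ext i j
  simp only [of_apply, mul_apply]
  conv_lhs => rw [← h.b.sum_repr (v j)]
  simp only [map_sum, map_smul, smul_eq_mul]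
  exact Finset.sum_congr rfl fun l _ ↦ mul_comm _ _

theorem minorMatrix_mulVec (h : HyperplaneData k C x) (f : C →ₗ[R] (m → R))
    (φ : Fin k → Module.Dual R (m → R)) (c : C) :
    (of fun i l ↦ φ i (f (h.b l))) *ᵥ (h.b.repr c) = fun i ↦ φ i (f c) := by
  ext i
  conv_rhs => rw [← h.b.sum_repr c]
  simp only [map_sum, map_smul, smul_eq_mul, mulVec, dotProduct, of_apply]
  exact Finset.sum_congr rfl fun l _ ↦ mul_comm _ _

theorem coe_eq_sum (h : HyperplaneData k C x) (c : C) :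
    (c : n → R) = ∑ l, h.b.repr c l • (h.b l : n → R) := by
  conv_lhs => rw [← h.b.sum_repr c]
  simp only [Submodule.coe_sum, Submodule.coe_smul]

/-- The minors of the restriction of `D` to the hyperplane lie in `P` iff the restriction is not
injective modulo `P`. -/
theorem minorIdeal_le_iff (h : HyperplaneData k C x) (D : Matrix m n R) (P : Ideal R)
    [hPp : P.IsPrime] :
    minorIdeal k (D.mulVecLin ∘ₗ C.subtype) ≤ P ↔
      ∃ c : n → R, x ⬝ᵥ c = 0 ∧ (∃ j, c j ∉ P) ∧ ∀ i, (D *ᵥ c) i ∈ P := by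
  constructor
  · intro hle
    by_contra! hcon
    let F : Matrix m (Fin k) R := of fun i l ↦ (D *ᵥ (h.b l : n → R)) i
    have hF (a : Fin k → R) : F *ᵥ a = D *ᵥ ((∑ l, a l • h.b l : C) : n → R) := by
      ext i
      have : D *ᵥ ((∑ l, a l • h.b l : C) : n → R) = ∑ l, a l • (D *ᵥ (h.b l : n → R)) := by
        rw [← mulVecLin_apply, Submodule.coe_sum, map_sum]
        simp
      rw [this]
      simp [F, mulVec, dotProduct, mul_comm]
    obtain ⟨Φ, hΦ⟩ := exists_det_notMem P F (by
      intro a ha l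
      rw [hF] at ha
      have hc : ∀ j, ((∑ l, a l • h.b l : C) : n → R) j ∈ P := by
        by_contra! hj
        obtain ⟨i, hi⟩ := hcon _ ((h.mem_iff _).1 (∑ l, a l • h.b l : C).2) hj
        exact hi (ha i)
      have := h.repr_mem P _ hc l
      rwa [h.b.repr_sum_self] at this)
    refine hΦ (hle (Ideal.subset_span ⟨h.b, fun i ↦ dotProductEquiv R m (Φ i), ?_⟩))
    congr 1
  · rintro ⟨c, hxc, ⟨j, hj⟩, hD⟩
    rw [minorIdeal, Ideal.span_le]
    rintro r ⟨v, φ, rfl⟩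
    rw [minor_eq h, det_mul]
    refine Ideal.mul_mem_right _ _ ?_
    let c' : C := ⟨c, (h.mem_iff c).2 hxc⟩
    let K : Matrix (Fin k) (Fin k) R := of fun i l ↦ φ i ((D.mulVecLin ∘ₗ C.subtype) (h.b l))
    change K.det ∈ P
    have hKa (i : Fin k) : (K *ᵥ (h.b.repr c')) i = φ i (D *ᵥ c) :=
      congrFun (h.minorMatrix_mulVec (D.mulVecLin ∘ₗ C.subtype) φ c') i
    have hKP (i : Fin k) : (K *ᵥ (h.b.repr c')) i ∈ P := by
      rw [hKa, LinearMap.pi_apply_eq_sum_univ]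
      exact Ideal.sum_mem _ fun l _ ↦ Ideal.mul_mem_right _ _ (hD l)
    -- Over the domain R/P, the determinant vanishes because the coordinates of `c` form a nonzero
    -- kernel vector.
    rw [← Ideal.Quotient.eq_zero_iff_mem, RingHom.map_det, ← exists_mulVec_eq_zero_iff]
    refine ⟨fun l ↦ Ideal.Quotient.mk P (h.b.repr c' l), fun h0 ↦ hj ?_, ?_⟩
    · have hr (l : Fin k) : h.b.repr c' l ∈ P :=
        Ideal.Quotient.eq_zero_iff_mem.1 (congrFun h0 l)
      have : c j = ∑ l, h.b.repr c' l * (h.b l : n → R) j := by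
        have := congrFun (h.coe_eq_sum c') j
        simpa only [Finset.sum_apply, Pi.smul_apply, smul_eq_mul] using this
      rw [this]
      exact Ideal.sum_mem _ fun l _ ↦ Ideal.mul_mem_right _ _ (hr l)
    · ext i
      have := Ideal.Quotient.eq_zero_iff_mem.2 (hKP i)
      simpa [mulVec, dotProduct] using this

/-- The minors of the restriction of `D` to the hyperplane kill the cokernel of `(Dᵀ, x)`. -/
theorem exists_smul_eq_of_mem_minorIdeal (h : HyperplaneData k C x) (D : Matrix m n R) {r : R}
    (hr : r ∈ minorIdeal k (D.mulVecLin ∘ₗ C.subtype)) (y : n → R) :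
    ∃ (t : R) (z : m → R), r • y = t • x + Dᵀ *ᵥ z := by
  let W : Submodule R (n → R) := (R ∙ x) ⊔ LinearMap.range Dᵀ.mulVecLin
  have hW (w : n → R) : w ∈ W ↔ ∃ (t : R) (z : m → R), w = t • x + Dᵀ *ᵥ z := by
    simp only [W, Submodule.mem_sup, Submodule.mem_span_singleton, LinearMap.mem_range]
    constructor
    · rintro ⟨_, ⟨t, rfl⟩, _, ⟨z, rfl⟩, rfl⟩
      exact ⟨t, z, rfl⟩
    · rintro ⟨t, z, rfl⟩
      exact ⟨_, ⟨t, rfl⟩, _, ⟨z, rfl⟩, rfl⟩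
  rw [← hW]
  have hle : minorIdeal k (D.mulVecLin ∘ₗ C.subtype) ≤
      W.comap (LinearMap.toSpanSingleton R _ y) := by
    rw [minorIdeal, Ideal.span_le]
    rintro r ⟨v, φ, rfl⟩
    rw [minor_eq h, det_mul, mul_comm]
    refine Ideal.mul_mem_left _ _ ?_
    let K : Matrix (Fin k) (Fin k) R := of fun i l ↦ φ i ((D.mulVecLin ∘ₗ C.subtype) (h.b l))
    change K.det • y ∈ W
    -- Cramer's rule: on C the functional ψ ∘ D equals det K · y. The difference vanishes on C,
    -- hence is a multiple of `x`.
    let ψ : Module.Dual R (m → R) :=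
      ∑ l, (y ⬝ᵥ (h.b l : n → R)) • ∑ i, K.adjugate l i • φ i
    obtain ⟨z, hz⟩ := (dotProductEquiv R m).surjective ψ
    have hψ (w : m → R) : z ⬝ᵥ w = ψ w := by rw [← hz]; rfl
    rw [hW]
    refine ⟨(K.det • y - Dᵀ *ᵥ z) ⬝ᵥ h.u, z, ?_⟩
    rw [← sub_eq_iff_eq_add]
    refine h.exists_eq_smul_of_forall_mem _ fun c hc ↦ ?_
    rw [sub_dotProduct, mulVec_transpose, ← dotProduct_mulVec, hψ, sub_eq_zero]
    let c' : C := ⟨c, hc⟩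
    have hKa : K *ᵥ (h.b.repr c') = fun i ↦ φ i (D *ᵥ c) :=
      h.minorMatrix_mulVec (D.mulVecLin ∘ₗ C.subtype) φ c'
    have hadj : K.adjugate *ᵥ (fun i ↦ φ i (D *ᵥ c)) = K.det • (h.b.repr c' : Fin k → R) := by
      rw [← hKa, mulVec_mulVec, adjugate_mul, smul_mulVec, one_mulVec]
    have hy : y ⬝ᵥ c = ∑ l, h.b.repr c' l * (y ⬝ᵥ (h.b l : n → R)) := by
      have : c = ∑ l, h.b.repr c' l • (h.b l : n → R) := h.coe_eq_sum c'
      conv_lhs => rw [this]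
      simp [dotProduct_sum, dotProduct_smul]
    rw [smul_dotProduct, hy, smul_eq_mul, Finset.mul_sum]
    simp only [ψ, LinearMap.sum_apply, LinearMap.smul_apply, smul_eq_mul]
    refine Finset.sum_congr rfl fun l _ ↦ ?_
    have := congrFun hadj l
    simp only [mulVec, dotProduct, Pi.smul_apply, smul_eq_mul] at this ⊢
    rw [this]; ring
  exact hle hr

end HyperplaneData

theorem nonempty_hyperplaneData_of_isCorankOneSummand {R : Type u} [CommRing R] {n : Type}
    [Fintype n] [DecidableEq n] {k : ℕ} {C : Submodule R (n → R)}
    (h : IsCorankOneSummand k C) : ∃ x : n → R, Nonempty (HyperplaneData k C x) := by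
  obtain ⟨L, hCL, ⟨e⟩, ⟨l⟩⟩ := h
  let π : (n → R) →ₗ[R] R := l.toLinearMap ∘ₗ L.projectionOnto C hCL.symm
  obtain ⟨x, hx⟩ := (dotProductEquiv R n).surjective π
  have hx' (v : n → R) : x ⬝ᵥ v = π v := by rw [← hx]; rfl
  refine ⟨x, ⟨(l.symm 1 : L), ?_, fun v ↦ ?_, Module.Basis.ofEquivFun e⟩⟩
  · rw [hx']
    simp [π]
  · rw [hx']
    simp [π]

/-- The kernel of a split functional is finite projective, hence free over a local ring; its rank
follows by counting. -/
theorem isCorankOneSummand_ker {R : Type u} [CommRing R] [IsLocalRing R] {n : Type}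
    [Fintype n] [DecidableEq n] {k : ℕ} (hk : Fintype.card n = k + 1) (x : n → R) {u : n → R}
    (hu : x ⬝ᵥ u = 1) :
    IsCorankOneSummand k (LinearMap.ker (dotProductEquiv R n x)) := by
  let φ := dotProductEquiv R n x
  have hφ (v : n → R) : φ v = x ⬝ᵥ v := rfl
  let s : R →ₗ[R] (n → R) := LinearMap.toSpanSingleton R _ u
  have hs (r : R) : φ (s r) = r := by simp [s, hφ, hu]
  have hinj : Function.Injective s := Function.LeftInverse.injective hs
  have hcompl : IsCompl (LinearMap.ker φ) (LinearMap.range s) := by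
    refine ⟨Submodule.disjoint_def.2 ?_, codisjoint_iff.2 (eq_top_iff.2 fun v _ ↦ ?_)⟩
    · rintro _ hv ⟨r, rfl⟩
      rw [LinearMap.mem_ker, hs] at hv
      rw [hv, map_zero]
    · refine Submodule.mem_sup.2 ⟨v - s (φ v), ?_, s (φ v), ⟨_, rfl⟩, by abel⟩
      rw [LinearMap.mem_ker, map_sub, hs, sub_self]
  have eL : R ≃ₗ[R] LinearMap.range s := LinearEquiv.ofInjective s hinj
  have hproj : Module.Projective R (LinearMap.ker φ) :=
    Module.Projective.of_split (LinearMap.ker φ).subtype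
      ((LinearMap.ker φ).projectionOnto _ hcompl) (by ext; simp)
  have hfin : Module.Finite R (LinearMap.ker φ) :=
    Module.Finite.of_surjective ((LinearMap.ker φ).projectionOnto _ hcompl)
      (Submodule.projectionOnto_surjective hcompl)
  have hfree : Module.Free R (LinearMap.ker φ) := Module.free_of_flat_of_isLocalRing
  have hrank : Module.finrank R (LinearMap.ker φ) = k := by
    have e := ((LinearEquiv.refl R (LinearMap.ker φ)).prodCongr eL).trans
      (Submodule.prodEquivOfIsCompl _ _ hcompl)
    have := e.finrank_eq
    rw [Module.finrank_prod, Module.finrank_self, Module.finrank_fintype_fun_eq_card, hk] at this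
    omega
  exact ⟨LinearMap.range s, hcompl,
    ⟨(Module.finBasisOfFinrankEq R _ hrank).equivFun⟩, ⟨eL.symm⟩⟩

end Matrix

/-! ### Prime avoidance and general position -/

theorem exists_isSMulRegular_of_forall_associatedPrimes {R : Type u} [CommRing R]
    [IsNoetherianRing R] {M : Type u} [AddCommGroup M] [Module R M] [Module.Finite R M]
    {J : Ideal R} (hJ : ∀ P ∈ associatedPrimes R M, ¬ J ≤ P) : ∃ r ∈ J, IsSMulRegular M r := by
  by_contra! hcon
  have hsub : (J : Set R) ⊆ ⋃ P ∈ associatedPrimes R M, ((id P : Ideal R) : Set R) := by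
    intro r hr
    simp only [id]
    rw [biUnion_associatedPrimes_eq_compl_regular]
    exact hcon r hr
  obtain ⟨P, hP, hle⟩ := (Ideal.subset_union_prime_finite (associatedPrimes.finite R M) ⊥ ⊥
    (fun P hP _ _ ↦ hP.1)).1 hsub
  exact hJ P hP hle

theorem not_subsingleton_hom_of_mem_associatedPrimes {R : Type u} [CommRing R]
    [IsNoetherianRing R] {M : Type u} [AddCommGroup M] [Module R M] {P : Ideal R}
    (hP : P ∈ associatedPrimes R M) : ¬ Subsingleton ((R ⧸ P) →ₗ[R] M) := by
  obtain ⟨hprime, e, he⟩ := isAssociatedPrime_iff.1 hP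
  have hmem (r : R) : r ∈ P ↔ r • e = 0 := by
    rw [he, Submodule.mem_colon_singleton, Submodule.mem_bot]
  intro hs
  let φ : (R ⧸ P) →ₗ[R] M := P.liftQ (LinearMap.toSpanSingleton R M e) fun r hr ↦ by
    simpa using (hmem r).1 hr
  have : φ (Ideal.Quotient.mk P 1) = 0 := by rw [hs.elim φ 0]; rfl
  have h1 : φ (Ideal.Quotient.mk P 1) = (1 : R) • e := rfl
  rw [h1] at this
  exact hprime.ne_top ((Ideal.eq_top_iff_one P).2 ((hmem 1).2 this))

/-- A module over a local ring with infinite residue field is not a finite union of proper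
submodules. -/
theorem IsLocalRing.exists_forall_notMem {R : Type u} [CommRing R] [IsLocalRing R]
    [Infinite (IsLocalRing.ResidueField R)] {M : Type*} [AddCommGroup M] [Module R M]
    (s : Set (Submodule R M)) (hs : s.Finite) (htop : ∀ H ∈ s, H ≠ ⊤) : ∃ x, ∀ H ∈ s, x ∉ H := by
  by_contra! hcon
  have hcov : ⋃ H ∈ hs.toFinset, ((id H : Submodule R M) : Set M) = Set.univ := by
    refine Set.eq_univ_of_forall fun x ↦ ?_
    obtain ⟨H, hH, hx⟩ := hcon x
    simp only [Set.mem_iUnion]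
    exact ⟨H, hs.mem_toFinset.2 hH, hx⟩
  -- By B. H. Neumann's lemma, some member of a finite cover has finite index. A nonzero cyclic
  -- submodule of the finite quotient then surjects onto the residue field, which would be finite.
  obtain ⟨H, hH, hfi⟩ := Submodule.exists_finiteIndex_of_cover hcov
  have : H.toAddSubgroup.FiniteIndex := hfi
  have hfin : Finite (M ⧸ H) := AddSubgroup.finite_quotient_of_finiteIndex
  obtain ⟨y, -, hy⟩ := SetLike.exists_of_lt (lt_top_iff_ne_top.2 (htop H (hs.mem_toFinset.1 hH)))
  let φ : R →ₗ[R] M ⧸ H := LinearMap.toSpanSingleton R _ (H.mkQ y)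
  have hker : LinearMap.ker φ ≤ IsLocalRing.maximalIdeal R := by
    refine IsLocalRing.le_maximalIdeal fun h ↦ hy ?_
    have h1 : (1 : R) ∈ LinearMap.ker φ := by rw [h]; trivial
    have h2 : (1 : R) • H.mkQ y = 0 := h1
    rw [one_smul] at h2
    exact (Submodule.Quotient.mk_eq_zero H).1 h2
  have : Finite (R ⧸ LinearMap.ker φ) := Finite.of_injective _ (LinearMap.ker_eq_bot.1
    (Submodule.ker_liftQ_eq_bot _ φ le_rfl le_rfl))
  have : Finite (IsLocalRing.ResidueField R) :=
    Finite.of_surjective _ (Ideal.Quotient.factor_surjective hker)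
  exact not_finite (IsLocalRing.ResidueField R)

/-! ### Grade at least four and associated primes -/

namespace Matrix

variable {R : Type u} [CommRing R] {m₁ m₂ m₃ : Type} [Fintype m₁] [Fintype m₂] [Fintype m₃]
  [DecidableEq m₁] [DecidableEq m₂] [DecidableEq m₃]
  {D₁ : Matrix Unit m₁ R} {D₂ : Matrix m₁ m₂ R} {D₃ : Matrix m₂ m₃ R} {I : Ideal R}

/-- `D₃` degenerates modulo every prime containing `I`. -/
theorem IsBiacyclic.exists_notMem_of_le (hB : IsBiacyclic D₁ D₂ D₃)
    (hI : I = Ideal.span (Set.range (D₁ ()))) {P : Ideal R} [P.IsPrime] (hP : I ≤ P) :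
    ∃ a : m₃ → R, (∃ j, a j ∉ P) ∧ ∀ i, (D₃ *ᵥ a) i ∈ P := by
  by_contra! hcon
  obtain ⟨Φ, hΦ⟩ := exists_det_notMem P D₃ fun a ha ↦ by
    by_contra! hj
    obtain ⟨i, hi⟩ := hcon a hj
    exact hi (ha i)
  -- The adjugate contracts `D₃` up to the factor det(Φ D₃), so this determinant lies in `I`.
  refine hΦ (hP ((mem_iff_exists_mul hI _).2 ((hB.exists_mul_eq_smul_one_iff _).2
    ⟨(Φ * D₃).adjugate * Φ, ?_⟩)))
  rw [Matrix.mul_assoc, adjugate_mul]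

theorem dotProduct_mem {m : Type} [Fintype m] (P : Ideal R) {z w : m → R} (hw : ∀ i, w i ∈ P) :
    z ⬝ᵥ w ∈ P :=
  Ideal.sum_mem _ fun i _ ↦ Ideal.mul_mem_left _ _ (hw i)

theorem transpose_mulVec_dotProduct_mem (D : Matrix m₂ m₃ R) (P : Ideal R) {a : m₃ → R}
    (ha : ∀ i, (D *ᵥ a) i ∈ P) (z : m₂ → R) : (Dᵀ *ᵥ z) ⬝ᵥ a ∈ P := by
  rw [mulVec_transpose, ← dotProduct_mulVec]
  exact dotProduct_mem P ha

variable {k : ℕ} {C : Submodule R (m₃ → R)} {x : m₃ → R}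

/-- If J ⊆ P, some `c` is nonzero modulo P with D₃c ≡ 0. For s in I, pairing s·e_j = D₃ᵀz with `c`
puts s·c_j in P. -/
theorem IsBiacyclic.le_of_minorIdeal_le (hB : IsBiacyclic D₁ D₂ D₃)
    (hI : I = Ideal.span (Set.range (D₁ ()))) (h : HyperplaneData k C x) {P : Ideal R}
    [hPp : P.IsPrime] (hP : minorIdeal k (D₃.mulVecLin ∘ₗ C.subtype) ≤ P) : I ≤ P := by
  obtain ⟨c, -, ⟨j, hj⟩, hc⟩ := (h.minorIdeal_le_iff D₃ P).1 hP
  intro s hs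
  obtain ⟨z, hz⟩ := (hB.mem_iff hI s).1 hs (Pi.single j 1)
  have := transpose_mulVec_dotProduct_mem D₃ P hc z
  rw [hz, smul_dotProduct, single_one_dotProduct, smul_eq_mul] at this
  exact (hPp.mem_or_mem this).resolve_right hj

/-- As V(J) ⊆ V(I), grade J ≥ 3. Prime avoidance gives an element of J regular on R/I, so Hom(R/J,
R/I) = 0; associated primes of Ext³(R/J, R) contain J, hence I, where `D₃` degenerates. -/
theorem IsBiacyclic.four_le_idealGrade [IsNoetherianRing R] (hB : IsBiacyclic D₁ D₂ D₃)
    (hI : I = Ideal.span (Set.range (D₁ ()))) (h : HyperplaneData k C x)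
    (hP : ∀ P ∈ associatedPrimes R (R ⧸ I),
      ¬ minorIdeal k (D₃.mulVecLin ∘ₗ C.subtype) ≤ P) :
    ((4 : ℕ) : ℕ∞) ≤ idealGrade (minorIdeal k (D₃.mulVecLin ∘ₗ C.subtype)) := by
  set J := minorIdeal k (D₃.mulVecLin ∘ₗ C.subtype) with hJ
  obtain ⟨r, hr, hreg⟩ := exists_isSMulRegular_of_forall_associatedPrimes hP
  have hgr : ((3 : ℕ) : ℕ∞) ≤ idealGrade I :=
    (le_moduleGrade_iff 3).2 ((hB.acyclic.dual_iff_subsingleton_ext (augmentation_surjective I)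
      (exact_augmentation hI)).1 hB.dual)
  have h3 : ∀ i < 3, Subsingleton (ModuleExt R (R ⧸ J) R i) := by
    refine ModuleExt.subsingleton_of_le_radical_annihilator hgr ?_
    rw [Ideal.annihilator_quotient, Ideal.radical_eq_sInf]
    refine le_sInf fun P hPJ ↦ ?_
    have := hPJ.2
    exact hB.le_of_minorIdeal_le hI h hPJ.1
  have hhom : Subsingleton ((R ⧸ J) →ₗ[R] (R ⧸ I)) :=
    IsSMulRegular.linearMap_subsingleton_of_mem_annihilator hreg
      (by rwa [Ideal.annihilator_quotient])
  refine (le_moduleGrade_iff 4).2 fun i hi ↦ ?_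
  rcases Nat.lt_succ_iff_lt_or_eq.1 hi with hi | rfl
  · exact h3 i hi
  · refine hB.acyclic.subsingleton_ext_three (augmentation_surjective I) (exact_augmentation hI)
      h3 hhom fun P hPa ↦ ?_
    have hPp := hPa.1
    refine hB.exists_notMem_of_le hI (hB.le_of_minorIdeal_le hI h ?_)
    intro s hs
    obtain ⟨-, e, he⟩ := isAssociatedPrime_iff.1 hPa
    rw [he, Submodule.mem_colon_singleton, Submodule.mem_bot]
    refine ModuleExt.smul_eq_zero_of_annihilates (fun v ↦ ?_) e
    have : s ∈ Module.annihilator R (R ⧸ J) := by rwa [Ideal.annihilator_quotient]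
    exact Module.mem_annihilator.1 this v

theorem IsBiacyclic.not_le_of_four_le_idealGrade [IsNoetherianRing R]
    (hB : IsBiacyclic D₁ D₂ D₃) (hI : I = Ideal.span (Set.range (D₁ ()))) {J P : Ideal R}
    (hJ : ((4 : ℕ) : ℕ∞) ≤ idealGrade J) (hP : P ∈ associatedPrimes R (R ⧸ I)) : ¬ J ≤ P := by
  intro hle
  refine not_subsingleton_hom_of_mem_associatedPrimes hP
    (hB.acyclic.subsingleton_hom (augmentation_surjective I) (exact_augmentation hI)
      (ModuleExt.subsingleton_of_le_radical_annihilator hJ ?_))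
  rw [Ideal.annihilator_quotient]
  exact hle.trans Ideal.le_radical

/-- If the cokernel of `D₃ᵀ` is cyclic at `P` and `x` does not vanish in its fiber at `P`, then
the minors of `D₃` on the hyperplane `x = 0` are not all in `P`. -/
theorem HyperplaneData.not_minorIdeal_le (h : HyperplaneData k C x) {P : Ideal R}
    [hPp : P.IsPrime] {g : m₃ → R}
    (hg : ∀ y, ∃ s ∉ P, ∃ (t : R) (z : m₂ → R), s • y = t • g + D₃ᵀ *ᵥ z)
    {a : m₃ → R} (ha : ∀ i, (D₃ *ᵥ a) i ∈ P) (hxa : x ⬝ᵥ a ∉ P) :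
    ¬ minorIdeal k (D₃.mulVecLin ∘ₗ C.subtype) ≤ P := by
  intro hle
  obtain ⟨c, hxc, ⟨j, hj⟩, hc⟩ := (h.minorIdeal_le_iff D₃ P).1 hle
  have hpair {y w : m₃ → R} {s t : R} {z : m₂ → R} (hy : s • y = t • g + D₃ᵀ *ᵥ z)
      (hw : ∀ i, (D₃ *ᵥ w) i ∈ P) : s * (y ⬝ᵥ w) - t * (g ⬝ᵥ w) ∈ P := by
    have := congrArg (· ⬝ᵥ w) hy
    simp only [smul_dotProduct, add_dotProduct, smul_eq_mul] at this
    rw [this, add_sub_cancel_left]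
    exact transpose_mulVec_dotProduct_mem D₃ P hw z
  -- Pairing with `c` is a functional on the fiber of ω at P, where `g` generates; it is nonzero
  -- because `c j` is outside P.
  have hgc : g ⬝ᵥ c ∉ P := by
    intro hgc
    obtain ⟨s, hs, t, z, hy⟩ := hg (Pi.single j 1)
    have := (P.sub_mem_iff_left (Ideal.mul_mem_left _ t hgc)).1 (hpair hy hc)
    rw [single_one_dotProduct] at this
    exact (hPp.mem_or_mem this).elim hs hj
  -- Since x · c = 0, the coefficient `t` of `x` along `g` lies in P, so `x` vanishes in the fiber
  -- and x · a must lie in P.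
  obtain ⟨s, hs, t, z, hy⟩ := hg x
  have h1 := hpair hy hc
  rw [hxc, mul_zero, zero_sub, neg_mem_iff] at h1
  have ht := (hPp.mem_or_mem h1).resolve_right hgc
  have h2 := (P.sub_mem_iff_left (Ideal.mul_mem_right _ _ ht)).1 (hpair hy ha)
  exact (hPp.mem_or_mem h2).elim hs hxa

/-- Cyclicity of ω_P with denominators cleared, so that generators and relations stay over `R`. -/
theorem IsBiacyclic.isGorensteinIdeal_map_iff (hB : IsBiacyclic D₁ D₂ D₃)
    (hI : I = Ideal.span (Set.range (D₁ ()))) {P : Ideal R} [hPp : P.IsPrime] (hP : I ≤ P) :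
    IsGorensteinIdeal (I.map (algebraMap R (Localization.AtPrime P))) ↔
      ∃ g : m₃ → R, ∀ y, ∃ s ∉ P, ∃ (t : R) (z : m₂ → R), s • y = t • g + D₃ᵀ *ᵥ z := by
  let S := Localization.AtPrime P
  let f := algebraMap R S
  have hne : I.map f ≠ ⊤ := by
    refine ne_top_of_le_ne_top (IsLocalRing.maximalIdeal.isMaximal S).ne_top ?_
    rw [← Localization.AtPrime.map_eq_maximalIdeal]
    exact Ideal.map_mono hP
  have hspan : I.map f = Ideal.span (Set.range ((D₁.map f) ())) := by
    rw [hI, Ideal.map_span, ← Set.range_comp]; rfl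
  rw [(hB.map P.primeCompl (S := S)).isGorensteinIdeal_iff hspan hne]
  have hmul (z : m₂ → R) : (D₃.map f)ᵀ *ᵥ (f ∘ z) = f ∘ (D₃ᵀ *ᵥ z) := by
    ext i
    rw [Function.comp_apply, RingHom.map_mulVec, transpose_map]
  have hden {T : Type} [Finite T] (w : T → S) : ∃ s ∉ P, ∃ a : T → R, f s • w = f ∘ a := by
    obtain ⟨b, hb⟩ := IsLocalization.exist_integer_multiples_of_finite P.primeCompl w
    choose c hc using hb
    refine ⟨b, b.2, c, ?_⟩
    ext t
    rw [Function.comp_apply, hc, Pi.smul_apply, smul_eq_mul, Algebra.smul_def]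
  have hu {s : R} (hs : s ∉ P) : IsUnit (f s) :=
    IsLocalization.map_units S (⟨s, hs⟩ : P.primeCompl)
  constructor
  · rintro ⟨g', hg'⟩
    obtain ⟨s₀, hs₀, g, hg⟩ := hden g'
    refine ⟨g, fun y ↦ ?_⟩
    obtain ⟨t', z', hy⟩ := hg' (f ∘ y)
    obtain ⟨s₁, hs₁, w, hw⟩ := hden (Sum.elim z' (fun _ : Unit ↦ t'))
    have hz : f s₁ • z' = f ∘ (w ∘ Sum.inl) := by
      ext i; exact congrFun hw (Sum.inl i)
    have ht : f s₁ * t' = f (w (Sum.inr ())) := congrFun hw (Sum.inr ())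
    have key : f ∘ ((s₀ * s₁) • y) =
        f ∘ (w (Sum.inr ()) • g + D₃ᵀ *ᵥ (s₀ • (w ∘ Sum.inl))) := by
      have e1 : f ∘ ((s₀ * s₁) • y) = (f s₀ * f s₁) • (f ∘ y) := by ext; simp
      have e2 : f ∘ (w (Sum.inr ()) • g + D₃ᵀ *ᵥ (s₀ • (w ∘ Sum.inl))) =
          f (w (Sum.inr ())) • (f ∘ g) + f s₀ • (f ∘ (D₃ᵀ *ᵥ (w ∘ Sum.inl))) := by
        ext; simp [mulVec_smul]
      rw [e1, e2, hy, ← hmul, ← hz, ← hg, ← ht, mulVec_smul]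
      rw [smul_add, smul_smul, smul_smul, smul_smul]
      congr 2
      ring
    have key' : ∃ s₂ ∉ P, s₂ • ((s₀ * s₁) • y) =
        s₂ • (w (Sum.inr ()) • g + D₃ᵀ *ᵥ (s₀ • (w ∘ Sum.inl))) := by
      obtain ⟨s, hs⟩ := (IsLocalizedModule.eq_iff_exists P.primeCompl
        (vecLocalization R S m₃)).1 key
      exact ⟨s, s.2, hs⟩
    obtain ⟨s₂, hs₂, h₂⟩ := key'
    refine ⟨s₂ * (s₀ * s₁), ?_, s₂ * w (Sum.inr ()), s₂ • s₀ • (w ∘ Sum.inl), ?_⟩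
    · exact hPp.mul_notMem hs₂ (hPp.mul_notMem hs₀ hs₁)
    · rw [mul_smul, h₂, smul_add, mul_smul, mulVec_smul D₃ᵀ s₂]
  · rintro ⟨g, hg⟩
    refine ⟨f ∘ g, fun y' ↦ ?_⟩
    obtain ⟨s₀, hs₀, y, hy⟩ := hden y'
    obtain ⟨s, hs, t, z, h⟩ := hg y
    obtain ⟨v, hv⟩ := (hu (hPp.mul_notMem hs hs₀)).exists_left_inv
    have e1 : f (s * s₀) • y' = f t • (f ∘ g) + (D₃.map f)ᵀ *ᵥ (f ∘ z) := by
      have : f ∘ (s • y) = f ∘ (t • g + D₃ᵀ *ᵥ z) := by rw [h]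
      have e2 : f ∘ (s • y) = f s • (f ∘ y) := by ext; simp
      have e3 : f ∘ (t • g + D₃ᵀ *ᵥ z) = f t • (f ∘ g) + f ∘ (D₃ᵀ *ᵥ z) := by ext; simp
      rw [map_mul, mul_smul, hy, hmul, ← e2, this, e3]
    refine ⟨v * f t, v • (f ∘ z), ?_⟩
    rw [mulVec_smul, mul_smul, ← smul_add, ← e1, smul_smul, hv, one_smul]

end Matrix

theorem le_of_mem_associatedPrimes_quotient {R : Type u} [CommRing R] {I P : Ideal R}
    (hP : P ∈ associatedPrimes R (R ⧸ I)) : I ≤ P := by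
  have := IsAssociatedPrime.annihilator_le hP
  rwa [Submodule.annihilator_top, Ideal.annihilator_quotient] at this

/-! ### Grade at most four and the choice of a hyperplane -/

namespace Matrix

variable {R : Type u} [CommRing R] {m₁ m₂ m₃ : Type} [Fintype m₁] [Fintype m₂] [Fintype m₃]
  [DecidableEq m₁] [DecidableEq m₂] [DecidableEq m₃]
  {D₁ : Matrix Unit m₁ R} {D₂ : Matrix m₁ m₂ R} {D₃ : Matrix m₂ m₃ R} {I : Ideal R}
  {k : ℕ} {C : Submodule R (m₃ → R)} {x : m₃ → R}

/-- If `J` has grade at least `5`, an embedding with cokernel killed by `J` is surjective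
on `Ext^3( , R)`. -/
theorem surjective_precomp_of_five_le_idealGrade [IsNoetherianRing R] {J : Ideal R}
    (hJ : ((5 : ℕ) : ℕ∞) ≤ idealGrade J) {M N : Type u} [AddCommGroup M] [Module R M]
    [AddCommGroup N] [Module R N] [Module.Finite R M] {f : N →ₗ[R] M}
    (hf : Function.Injective f) (hJM : ∀ r ∈ J, ∀ v, r • v ∈ LinearMap.range f) :
    Function.Surjective ((Abelian.Ext.mk₀ (ModuleCat.ofHom f)).precompOfLinear R
      (ModuleCat.of R R) (a := 3) (b := 3) (zero_add 3)) := by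
  refine ModuleExt.surjective_precomp hf (g := (LinearMap.range f).mkQ) (fun v ↦ ?_)
    (Submodule.mkQ_surjective _) ?_
  · rw [← LinearMap.mem_ker, Submodule.ker_mkQ]; rfl
  · refine ModuleExt.subsingleton_of_le_radical_annihilator hJ
      (le_trans (fun r hr ↦ ?_) Ideal.le_radical) 4 (by norm_num)
    refine Module.mem_annihilator.2 fun w ↦ ?_
    obtain ⟨v, rfl⟩ := Submodule.mkQ_surjective _ w
    rw [← map_smul]
    exact (Submodule.Quotient.mk_eq_zero _).2 (hJM r hr v)

/-- If the minors of `D₃` on a hyperplane have grade at least `5`, then the cokernel of `D₃ᵀ` is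
cyclic. -/
theorem IsBiacyclic.exists_generator_of_five_le [IsNoetherianRing R]
    (hB : IsBiacyclic D₁ D₂ D₃) (hI : I = Ideal.span (Set.range (D₁ ())))
    (h : HyperplaneData k C x)
    (hJ : ((5 : ℕ) : ℕ∞) ≤ idealGrade (minorIdeal k (D₃.mulVecLin ∘ₗ C.subtype))) :
    ∃ g : m₃ → R, ∀ y, ∃ (t : R) (z : m₂ → R), y = t • g + D₃ᵀ *ᵥ z := by
  set J := minorIdeal k (D₃.mulVecLin ∘ₗ C.subtype)
  obtain ⟨r, hr, hreg⟩ := exists_isSMulRegular_of_forall_associatedPrimes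
    (M := R ⧸ I) (J := J) fun P hP ↦
      hB.not_le_of_four_le_idealGrade hI (le_trans (by norm_num) hJ) hP
  let ω := (m₃ → R) ⧸ LinearMap.range D₃ᵀ.mulVecLin
  have hω (y : m₃ → R) : (Submodule.Quotient.mk y : ω) = 0 ↔ ∃ z, D₃ᵀ *ᵥ z = y :=
    Submodule.Quotient.mk_eq_zero (LinearMap.range D₃ᵀ.mulVecLin)
  let f : (R ⧸ I) →ₗ[R] ω := I.liftQ (LinearMap.toSpanSingleton R ω (Submodule.Quotient.mk x))
    fun s hs ↦ (hω (s • x)).2 ((hB.mem_iff hI s).1 hs x)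
  have hfapp (s : R) : f (Submodule.Quotient.mk s) = Submodule.Quotient.mk (s • x) := rfl
  -- If s·x = 0 in ω, then r·s kills ω because `r` carries ω into Rx; so r·s is in I, and `r` is
  -- regular on R/I.
  have hf : Function.Injective f := by
    rw [← LinearMap.ker_eq_bot, LinearMap.ker_eq_bot']
    intro v hv
    obtain ⟨s, rfl⟩ := Submodule.mkQ_surjective _ v
    rw [Submodule.mkQ_apply, hfapp, hω] at hv
    obtain ⟨w, hw⟩ := hv
    have : r * s ∈ I := by
      rw [hB.mem_iff hI]
      intro y
      obtain ⟨t, z, hy⟩ := h.exists_smul_eq_of_mem_minorIdeal D₃ hr y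
      refine ⟨t • w + s • z, ?_⟩
      rw [mulVec_add, mulVec_smul, mulVec_smul, hw, mul_comm, mul_smul, hy, smul_add,
        smul_comm t s x]
    have h0 : r • (I.mkQ s) = r • (0 : R ⧸ I) := by
      rw [← map_smul, smul_zero]
      exact (Submodule.Quotient.mk_eq_zero I).2 this
    exact hreg h0
  have hsurj := surjective_precomp_of_five_le_idealGrade hJ hf (by
    intro r hr v
    obtain ⟨y, rfl⟩ := Submodule.mkQ_surjective _ v
    obtain ⟨t, z, hy⟩ := h.exists_smul_eq_of_mem_minorIdeal D₃ hr y
    refine ⟨Submodule.Quotient.mk t, ?_⟩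
    rw [← map_smul, hy, map_add, hfapp]
    have : (LinearMap.range D₃ᵀ.mulVecLin).mkQ (D₃ᵀ *ᵥ z) = 0 := (hω _).2 ⟨z, rfl⟩
    rw [this, add_zero]
    rfl)
  obtain ⟨e⟩ := hB.acyclic.nonempty_ext_three_equiv (augmentation_surjective I)
    (exact_augmentation hI)
  obtain ⟨e'⟩ := hB.dual.nonempty_ext_three_equiv
    (ε := (LinearMap.range D₃ᵀ.mulVecLin).mkQ) (Submodule.mkQ_surjective _)
    (fun v ↦ by rw [← LinearMap.mem_ker, Submodule.ker_mkQ]; rfl)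
  -- The dual complex resolves ω, so Ext³(ω, R) is the cokernel of `D₁`, a quotient of R.
  -- Composition with Ext³(f, R) exhibits ω as cyclic.
  let T : (Unit → R) →ₗ[R] ω := e.toLinearMap ∘ₗ
    (Abelian.Ext.mk₀ (ModuleCat.ofHom f)).precompOfLinear R (ModuleCat.of R R) (zero_add 3) ∘ₗ
    e'.symm.toLinearMap ∘ₗ Submodule.mkQ _
  have hT : Function.Surjective T :=
    e.surjective.comp (hsurj.comp (e'.symm.surjective.comp (Submodule.mkQ_surjective _)))
  obtain ⟨g, hg⟩ := Submodule.mkQ_surjective _ (T fun _ ↦ 1)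
  refine ⟨g, fun y ↦ ?_⟩
  obtain ⟨t, ht⟩ := hT (Submodule.Quotient.mk y)
  have : (Submodule.Quotient.mk (y - t () • g) : ω) = 0 := by
    have h1 : t = t () • fun _ ↦ (1 : R) := by ext; simp
    have h2 : T t = t () • T fun _ ↦ 1 := by
      conv_lhs => rw [h1, map_smul]
    rw [Submodule.Quotient.mk_sub, ← ht, h2, ← hg, Submodule.Quotient.mk_smul]
    exact sub_self _
  obtain ⟨z, hz⟩ := (hω _).1 this
  exact ⟨t (), z, by rw [hz]; abel⟩

/-- With `x = r g + D₃ᵀ z₀` for a generator `g` of the cokernel of `D₃ᵀ` and a nonunit `r` regular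
modulo `I`, the minors of `D₃` on the hyperplane `x = 0` have grade at most `4`. -/
theorem IsBiacyclic.not_five_le_of_generator [IsNoetherianRing R] [IsLocalRing R]
    (hB : IsBiacyclic D₁ D₂ D₃) (hI : I = Ideal.span (Set.range (D₁ ()))) (hne : I ≠ ⊤)
    {g : m₃ → R} (hg : ∀ y, ∃ (t : R) (z : m₂ → R), y = t • g + D₃ᵀ *ᵥ z)
    {r : R} (hr : r ∈ IsLocalRing.maximalIdeal R) (hreg : IsSMulRegular (R ⧸ I) r)
    {z₀ : m₂ → R} (hx : x = r • g + D₃ᵀ *ᵥ z₀) (h : HyperplaneData k C x) :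
    ¬ ((5 : ℕ) : ℕ∞) ≤ idealGrade (minorIdeal k (D₃.mulVecLin ∘ₗ C.subtype)) := by
  intro hJ
  have hsurj := surjective_precomp_of_five_le_idealGrade hJ
    (f := r • (LinearMap.id : (R ⧸ I) →ₗ[R] (R ⧸ I))) hreg (by
    intro ρ hρ v
    obtain ⟨s, rfl⟩ := Submodule.mkQ_surjective _ v
    obtain ⟨t, z, hy⟩ := h.exists_smul_eq_of_mem_minorIdeal D₃ hρ g
    -- In ω, ρg = tx = trg, so ρ − tr kills the generator. Thus J ⊆ (r) + I, and J kills the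
    -- cokernel of multiplication by `r` on R/I.
    have hmem : ρ - t * r ∈ I := by
      rw [hB.mem_iff hI]
      intro y
      obtain ⟨t', z', rfl⟩ := hg y
      refine ⟨t' • (t • z₀ + z) + (ρ - t * r) • z', ?_⟩
      have hk : D₃ᵀ *ᵥ (t • z₀ + z) = (ρ - t * r) • g := by
        rw [mulVec_add, mulVec_smul, sub_smul, hy, hx]
        module
      rw [mulVec_add, mulVec_smul, hk, mulVec_smul]
      module
    refine ⟨I.mkQ (t * s), ?_⟩
    rw [LinearMap.smul_apply, LinearMap.id_apply, ← map_smul, ← map_smul, ← sub_eq_zero,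
      ← map_sub]
    refine (Submodule.Quotient.mk_eq_zero I).2 ?_
    have : r • (t * s) - ρ • s = -(s * (ρ - t * r)) := by
      simp only [smul_eq_mul]; ring
    rw [this]
    exact I.neg_mem (I.mul_mem_left _ hmem))
  have hsmul (e : ModuleExt R (R ⧸ I) R 3) :
      (Abelian.Ext.mk₀ (ModuleCat.ofHom (r • (LinearMap.id : (R ⧸ I) →ₗ[R] (R ⧸ I))))).comp e
        (zero_add 3) = r • e := by
    rw [show ModuleCat.ofHom (r • (LinearMap.id : (R ⧸ I) →ₗ[R] (R ⧸ I))) =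
      r • 𝟙 (ModuleCat.of R (R ⧸ I)) from rfl, Abelian.Ext.mk₀_smul, Abelian.Ext.smul_comp,
      Abelian.Ext.mk₀_id_comp]
  obtain ⟨e⟩ := hB.acyclic.nonempty_ext_three_equiv (augmentation_surjective I)
    (exact_augmentation hI)
  have hfin : Module.Finite R (ModuleExt R (R ⧸ I) R 3) := Module.Finite.equiv e.symm
  have hbot : (⊤ : Submodule R (ModuleExt R (R ⧸ I) R 3)) = ⊥ := by
    refine Submodule.eq_bot_of_le_smul_of_le_jacobson_bot (IsLocalRing.maximalIdeal R) _
      Module.Finite.fg_top (fun e _ ↦ ?_) (IsLocalRing.maximalIdeal_le_jacobson ⊥)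
    obtain ⟨e', he'⟩ := hsurj e
    rw [← he']
    change (Abelian.Ext.mk₀ _).comp e' (zero_add 3) ∈ _
    rw [hsmul]
    exact Submodule.smul_mem_smul hr trivial
  have h3 := ((moduleGrade_eq_iff 3).1 (hB.moduleGrade_eq hI hne)).2
  exact not_subsingleton_iff_nontrivial.2 h3
    ((Submodule.subsingleton_iff R).1 (subsingleton_of_bot_eq_top hbot.symm))

/-- A cyclic cokernel of `D₃ᵀ` with at least two rows forces a unit entry in the column space. -/
theorem exists_isUnit_transpose_mulVec [IsLocalRing R] [Nontrivial m₃]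
    {g : m₃ → R} (hg : ∀ y, ∃ (t : R) (z : m₂ → R), y = t • g + D₃ᵀ *ᵥ z) :
    ∃ (z : m₂ → R) (j : m₃), IsUnit ((D₃ᵀ *ᵥ z) j) := by
  by_contra! hcon
  let 𝔪 := IsLocalRing.maximalIdeal R
  have hm (z : m₂ → R) (j : m₃) : (D₃ᵀ *ᵥ z) j ∈ 𝔪 := hcon z j
  obtain ⟨i, j, hij⟩ := exists_pair_ne m₃
  have h1 : (1 : R) ∉ 𝔪 := fun h ↦ h isUnit_one
  obtain ⟨t, z, h⟩ := hg (Pi.single i 1)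
  obtain ⟨t', z', h'⟩ := hg (Pi.single j 1)
  have hp : 𝔪.IsPrime := (IsLocalRing.maximalIdeal.isMaximal R).isPrime
  have hii := congrFun h i
  have hi := congrFun h j
  have hjj := congrFun h' j
  simp only [Pi.single_eq_same, Pi.single_eq_of_ne hij.symm, Pi.add_apply, Pi.smul_apply,
    smul_eq_mul] at hii hi hjj
  -- Modulo 𝔪 two distinct basis vectors would both be multiples of `g`.
  have htg : t * g j ∈ 𝔪 := by
    rw [show t * g j = -(D₃ᵀ *ᵥ z) j by linear_combination -hi]
    exact 𝔪.neg_mem (hm z j)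
  rcases hp.mem_or_mem htg with ht | hgj
  · exact h1 (hii ▸ 𝔪.add_mem (𝔪.mul_mem_right _ ht) (hm z i))
  · exact h1 (hjj ▸ 𝔪.add_mem (𝔪.mul_mem_left _ hgj) (hm z' j))

theorem exists_hyperplaneData [IsLocalRing R] (hk : Fintype.card m₃ = k + 1) {j : m₃}
    (hj : IsUnit (x j)) :
    IsCorankOneSummand k (LinearMap.ker (dotProductEquiv R m₃ x)) ∧
      Nonempty (HyperplaneData k (LinearMap.ker (dotProductEquiv R m₃ x)) x) := by
  obtain ⟨v, hv⟩ := hj.exists_right_inv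
  have hu : x ⬝ᵥ Pi.single j v = 1 := by rw [dotProduct_single, hv]
  have hC := isCorankOneSummand_ker hk x hu
  refine ⟨hC, ?_⟩
  obtain ⟨L, -, ⟨e⟩, -⟩ := hC
  exact ⟨⟨Pi.single j v, hu, fun v ↦ Iff.rfl, Module.Basis.ofEquivFun e⟩⟩

variable [IsNoetherianRing R] [IsLocalRing R]

theorem IsBiacyclic.isGenericallyGorenstein_of_four_le (hB : IsBiacyclic D₁ D₂ D₃)
    (hI : I = Ideal.span (Set.range (D₁ ()))) (hC : IsCorankOneSummand k C)
    (hJ : ((4 : ℕ) : ℕ∞) ≤ idealGrade (minorIdeal k (D₃.mulVecLin ∘ₗ C.subtype))) :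
    IsGenericallyGorenstein I := by
  obtain ⟨x, ⟨h⟩⟩ := nonempty_hyperplaneData_of_isCorankOneSummand hC
  intro P hPp hP
  have hIP : I ≤ P := le_of_mem_associatedPrimes_quotient hP
  rw [hB.isGorensteinIdeal_map_iff hI hIP]
  obtain ⟨r, hr, hrP⟩ := SetLike.not_le_iff_exists.1 (hB.not_le_of_four_le_idealGrade hI hJ hP)
  exact ⟨x, fun y ↦ ⟨r, hrP, h.exists_smul_eq_of_mem_minorIdeal D₃ hr y⟩⟩

/-- The vectors vanishing in the fiber at `P` of the cokernel of `Dᵀ`. -/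
def fiberKernel (D : Matrix m₂ m₃ R) (P : Ideal R) : Submodule R (m₃ → R) where
  carrier := {x | ∀ a, (∀ i, (D *ᵥ a) i ∈ P) → x ⬝ᵥ a ∈ P}
  zero_mem' a _ := by simp
  add_mem' hx hy a ha := by
    rw [add_dotProduct]; exact P.add_mem (hx a ha) (hy a ha)
  smul_mem' r x hx a ha := by
    rw [smul_dotProduct]; exact P.mul_mem_left r (hx a ha)

/-- The fiber of ω at P is nonzero because P contains the annihilator of ω. -/
theorem IsBiacyclic.fiberKernel_ne_top (hB : IsBiacyclic D₁ D₂ D₃)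
    (hI : I = Ideal.span (Set.range (D₁ ()))) {P : Ideal R} [P.IsPrime] (hP : I ≤ P) :
    fiberKernel D₃ P ≠ ⊤ := by
  intro htop
  obtain ⟨a, ⟨j, hj⟩, ha⟩ := hB.exists_notMem_of_le hI hP
  have : Pi.single j 1 ∈ fiberKernel D₃ P := by rw [htop]; trivial
  have := this a ha
  rw [single_one_dotProduct] at this
  exact hj this

theorem IsBiacyclic.four_le_of_notMem_fiberKernel (hB : IsBiacyclic D₁ D₂ D₃)
    (hI : I = Ideal.span (Set.range (D₁ ()))) (hG : IsGenericallyGorenstein I)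
    (h : HyperplaneData k C x) (hx : ∀ P ∈ associatedPrimes R (R ⧸ I), x ∉ fiberKernel D₃ P) :
    ((4 : ℕ) : ℕ∞) ≤ idealGrade (minorIdeal k (D₃.mulVecLin ∘ₗ C.subtype)) := by
  refine hB.four_le_idealGrade hI h fun P hP ↦ ?_
  have hPp := hP.1
  have hIP : I ≤ P := le_of_mem_associatedPrimes_quotient hP
  obtain ⟨g, hg⟩ := (hB.isGorensteinIdeal_map_iff hI hIP).1 (hG P hP)
  have hxP : ¬ ∀ a, (∀ i, (D₃ *ᵥ a) i ∈ P) → x ⬝ᵥ a ∈ P := hx P hP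
  push Not at hxP
  obtain ⟨a, ha, hxa⟩ := hxP
  exact h.not_minorIdeal_le hg ha hxa

theorem IsBiacyclic.exists_four_le [Infinite (IsLocalRing.ResidueField R)]
    (hB : IsBiacyclic D₁ D₂ D₃) (hI : I = Ideal.span (Set.range (D₁ ())))
    (hk : Fintype.card m₃ = k + 1) (hG : IsGenericallyGorenstein I) :
    ∃ (C : Submodule R (m₃ → R)) (x : m₃ → R), IsCorankOneSummand k C ∧
      Nonempty (HyperplaneData k C x) ∧
      ((4 : ℕ) : ℕ∞) ≤ idealGrade (minorIdeal k (D₃.mulVecLin ∘ₗ C.subtype)) := by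
  let 𝔪 := IsLocalRing.maximalIdeal R
  -- Avoiding 𝔪A₃* gives `x` a unit entry, so that its kernel is a free summand of corank one.
  let H₀ : Submodule R (m₃ → R) := Submodule.pi Set.univ fun _ ↦ 𝔪
  obtain ⟨j₀⟩ : Nonempty m₃ := Fintype.card_pos_iff.1 (by omega)
  obtain ⟨x, hx⟩ := IsLocalRing.exists_forall_notMem
    (insert H₀ (fiberKernel D₃ '' associatedPrimes R (R ⧸ I)))
    (((associatedPrimes.finite R (R ⧸ I)).image _).insert _) (by
      rintro H (rfl | ⟨P, hP, rfl⟩)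
      · intro htop
        have : Pi.single j₀ 1 ∈ H₀ := by rw [htop]; trivial
        have := this j₀ trivial
        rw [Pi.single_eq_same] at this
        exact this isUnit_one
      · have hPp := hP.1
        exact hB.fiberKernel_ne_top hI (le_of_mem_associatedPrimes_quotient hP))
  have hx₀ : ∃ j, IsUnit (x j) := by
    by_contra! hcon
    exact hx H₀ (Set.mem_insert _ _) fun j _ ↦ hcon j
  obtain ⟨j, hj⟩ := hx₀
  obtain ⟨hC, ⟨h⟩⟩ := exists_hyperplaneData hk hj
  exact ⟨_, x, hC, ⟨h⟩, hB.four_le_of_notMem_fiberKernel hI hG h fun P hP ↦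
    hx _ (Set.mem_insert_of_mem _ ⟨P, hP, rfl⟩)⟩

/-- If I is not Gorenstein, any choice with grade at least 4 works. Otherwise `x` is taken in the
class of r·g; `hk1` gives ω at least two rows, hence a relation D₃ᵀz₀ with a unit entry that makes
`x` unimodular. -/
theorem IsBiacyclic.exists_eq_four [Infinite (IsLocalRing.ResidueField R)]
    (hB : IsBiacyclic D₁ D₂ D₃) (hI : I = Ideal.span (Set.range (D₁ ()))) (hne : I ≠ ⊤)
    (hk : Fintype.card m₃ = k + 1) (hk1 : 1 ≤ k) (hG : IsGenericallyGorenstein I)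
    (hor : ¬ IsGorensteinIdeal I ∨ ((4 : ℕ) : ℕ∞) ≤ idealGrade (IsLocalRing.maximalIdeal R)) :
    ∃ C : Submodule R (m₃ → R), IsCorankOneSummand k C ∧
      idealGrade (minorIdeal k (D₃.mulVecLin ∘ₗ C.subtype)) = (4 : ℕ) := by
  have heq {J : Ideal R} (h4 : ((4 : ℕ) : ℕ∞) ≤ idealGrade J)
      (h5 : ¬ ((5 : ℕ) : ℕ∞) ≤ idealGrade J) : idealGrade J = (4 : ℕ) := by
    refine le_antisymm ?_ h4
    rw [not_le] at h5
    exact ENat.lt_add_one_iff (ENat.natCast_ne_top 4) |>.1 h5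
  by_cases hGor : IsGorensteinIdeal I
  · have hdepth := hor.resolve_left (not_not.2 hGor)
    obtain ⟨g, hg⟩ := (hB.isGorensteinIdeal_iff hI hne).1 hGor
    obtain ⟨r, hr, hreg⟩ := exists_isSMulRegular_of_forall_associatedPrimes (M := R ⧸ I)
      (J := IsLocalRing.maximalIdeal R) fun P hP ↦
        hB.not_le_of_four_le_idealGrade hI hdepth hP
    have : Nontrivial m₃ := Fintype.one_lt_card_iff_nontrivial.1 (by omega)
    obtain ⟨z₀, j, hj⟩ := exists_isUnit_transpose_mulVec hg
    -- Adding r·g with `r` in the maximal ideal keeps the entry a unit.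
    have hxj : IsUnit ((r • g + D₃ᵀ *ᵥ z₀) j) := by
      by_contra hcon
      refine (show (D₃ᵀ *ᵥ z₀) j ∉ IsLocalRing.maximalIdeal R from fun hn ↦ hn hj) ?_
      have hcon' : (r • g + D₃ᵀ *ᵥ z₀) j ∈ IsLocalRing.maximalIdeal R := hcon
      exact (Ideal.add_mem_iff_right _ (Ideal.mul_mem_right (g j) _ hr)).1 hcon'
    obtain ⟨hC, ⟨h⟩⟩ := exists_hyperplaneData hk hxj
    refine ⟨_, hC, heq (hB.four_le_of_notMem_fiberKernel hI hG h fun P hP hmem ↦ ?_)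
      (hB.not_five_le_of_generator hI hne hg hr hreg rfl h)⟩
    -- At an associated prime P, `r` is outside P and `g` generates the nonzero fiber of ω, so `x`,
    -- with class r·g, is nonzero there.
    have hPp := hP.1
    have hIP : I ≤ P := le_of_mem_associatedPrimes_quotient hP
    obtain ⟨a, ⟨i, hi⟩, ha⟩ := hB.exists_notMem_of_le hI hIP
    have h1 := hmem a ha
    rw [add_dotProduct, smul_dotProduct, smul_eq_mul,
      Ideal.add_mem_iff_left _ (transpose_mulVec_dotProduct_mem D₃ P ha z₀)] at h1
    have hrP : r ∉ P := by
      intro hrP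
      have : r ∈ ⋃ Q ∈ associatedPrimes R (R ⧸ I), (Q : Set R) := Set.mem_biUnion hP hrP
      rw [biUnion_associatedPrimes_eq_compl_regular] at this
      exact this hreg
    have hga := (hPp.mem_or_mem h1).resolve_left hrP
    obtain ⟨t, z, hy⟩ := hg (Pi.single i 1)
    have h2 := congrArg (· ⬝ᵥ a) hy
    simp only [single_one_dotProduct, add_dotProduct, smul_dotProduct, smul_eq_mul] at h2
    exact hi (h2 ▸ P.add_mem (P.mul_mem_left _ hga) (transpose_mulVec_dotProduct_mem D₃ P ha z))
  · obtain ⟨C, x, hC, ⟨h⟩, h4⟩ := hB.exists_four_le hI hk hG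
    exact ⟨C, hC, heq h4 fun h5 ↦
      hGor ((hB.isGorensteinIdeal_iff hI hne).2 (hB.exists_generator_of_five_le hI h h5))⟩

end Matrix

/-! ### Passage from linear maps to matrices -/

theorem mainTheorem2 {R : Type u} [CommRing R] [IsLocalRing R] [IsNoetherianRing R]
    [Infinite (IsLocalRing.ResidueField R)]
    (p q : ℕ) (hp : 1 ≤ p) (hq : 3 ≤ q)
    (d₁ : (Fin (p + 2) → R) →ₗ[R] R)
    (d₂ : (Fin (p + q) → R) →ₗ[R] (Fin (p + 2) → R))
    (d₃ : (Fin (q - 1) → R) →ₗ[R] (Fin (p + q) → R))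
    (I : Ideal R) (hA : IsResolutionOfQuotient d₁ d₂ d₃ I) (hI : idealGrade I = 3) :
    ((∃ C : Submodule R (Fin (q - 1) → R), IsCorankOneSummand (q - 2) C ∧
        4 ≤ idealGrade (minorIdeal (q - 2) (d₃ ∘ₗ C.subtype))) ↔ IsGenericallyGorenstein I) ∧
    ((¬ IsGorensteinIdeal I ∨ 4 ≤ idealGrade (IsLocalRing.maximalIdeal R)) →
      ((∃ C : Submodule R (Fin (q - 1) → R), IsCorankOneSummand (q - 2) C ∧
        idealGrade (minorIdeal (q - 2) (d₃ ∘ₗ C.subtype)) = 4) ↔ IsGenericallyGorenstein I)) := by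
  let D₁ : Matrix Unit (Fin (p + 2)) R := Matrix.of fun _ j ↦ d₁ (Pi.single j 1)
  have hD₁ (v : Fin (p + 2) → R) : D₁.mulVecLin v = fun _ ↦ d₁ v := by
    ext i
    conv_rhs => rw [pi_eq_sum_univ' v]
    simp [D₁, Matrix.mulVec, dotProduct, mul_comm]
  obtain ⟨D₂, rfl⟩ : ∃ D : Matrix _ _ R, D.mulVecLin = d₂ :=
    ⟨LinearMap.toMatrix' d₂, Matrix.toLin'_toMatrix' d₂⟩
  obtain ⟨D₃, rfl⟩ : ∃ D : Matrix _ _ R, D.mulVecLin = d₃ :=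
    ⟨LinearMap.toMatrix' d₃, Matrix.toLin'_toMatrix' d₃⟩
  have hac : Matrix.IsAcyclic D₁ D₂ D₃ := by
    refine ⟨fun v ↦ ?_, hA.exact_d₃_d₂, hA.injective_d₃⟩
    rw [hD₁, ← hA.exact_d₂_d₁ v]
    exact ⟨fun h ↦ congrFun h (), fun h ↦ funext fun _ ↦ h⟩
  have hspan : I = Ideal.span (Set.range (D₁ ())) := by
    ext s
    rw [Matrix.mem_iff_exists_mulVec rfl, ← hA.range_d₁]
    refine exists_congr fun w ↦ ?_
    rw [← Matrix.mulVecLin_apply, hD₁]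
    exact ⟨fun h ↦ funext fun _ ↦ h, fun h ↦ congrFun h ()⟩
  have hgr := (moduleGrade_eq_iff (M := R ⧸ I) 3).1 hI
  have hB : Matrix.IsBiacyclic D₁ D₂ D₃ :=
    ⟨hac, (hac.dual_iff_subsingleton_ext (Matrix.augmentation_surjective I)
      (Matrix.exact_augmentation hspan)).2 hgr.1⟩
  have hne : I ≠ ⊤ := by
    rintro rfl
    exact not_subsingleton_iff_nontrivial.2 hgr.2
      (ModuleExt.subsingleton_of_subsingleton (Ideal.Quotient.subsingleton_iff.2 rfl) 3)
  have hk : Fintype.card (Fin (q - 1)) = (q - 2) + 1 := by rw [Fintype.card_fin]; omega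
  refine ⟨⟨fun ⟨C, hC, h4⟩ ↦ hB.isGenericallyGorenstein_of_four_le hspan hC h4, fun hG ↦ ?_⟩,
    fun hor ↦ ⟨fun ⟨C, hC, h4⟩ ↦ hB.isGenericallyGorenstein_of_four_le hspan hC h4.ge,
      fun hG ↦ hB.exists_eq_four hspan hne hk (by omega) hG hor⟩⟩
  obtain ⟨C, x, hC, -, h4⟩ := hB.exists_four_le hspan hk hG
  exact ⟨C, hC, h4⟩
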